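/- Let $n=m+1$, $r\in\mathbb N\cup\{\infty\}$ with $r\ge 1$, and $\varepsilon_0>0$. Consider $$z'=\tilde f(z,\alpha,\varepsilon),\qquad \alpha'=\varepsilon\,\tilde g(z,\alpha,\varepsilon),\qquad (z,\alpha)\in\mathbb R^n\times\mathbb R,$$ with $\tilde f:\mathbb R^n\times\mathbb R\times(-\varepsilon_0,\varepsilon_0)\to\mathbb R^n$ and $\tilde g:\mathbb R^n\times\mathbb R\times(-\varepsilon_0,\varepsilon_0)\to\mathbb R$ of class $C^r$ in $(z,\alpha,\varepsilon)$. Suppose that for $\alpha=\alpha_*$ the layer problem $z'=\tilde f(z,\alpha_*,0)$ has a hyperbolic limit cycle $\Gamma_{\alpha_*}$ of minimal period $T_{\alpha_*}$ (a non-constant periodic orbit whose Floquet multipliers, apart from one trivial multiplier $1$, all lie off the unit circle) through a point $z_*$. Write $z=(x,y)\in\mathbb R^{n-1}\times\mathbb R$, $z_*=(x_*,y_*)$, let $Y:\mathbb R^{n-1}\times\mathbb R\to\mathbb R$ be $C^r$ with $Y(x_*,\alpha_*)=y_*$, and suppose that the hypersurface $\{y=Y(x,\alpha)\}\subset\mathbb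 R^{n+1}$ is transverse to the flow of the layer problem at $(z_*,\alpha_*)$, i.e. $(\tilde f(z_*,\alpha_*,0),0)$ is not tangent to it there. Then, inside any prescribed neighbourhood of $(x_*,\alpha_*)$ in $\mathbb R^{n-1}\times\mathbb R$, there are an open set $W$, an open neighbourhood $V_x$ of $x_*$ and an open interval $V_\alpha\ni\alpha_*$ with $U:=V_x\times V_\alpha\subseteq W$, and there is $\varepsilon_1\in(0,\varepsilon_0]$, such that, with $\Delta:=\{(x,Y(x,\alpha),\alpha):(x,\alpha)\in W\}$, the following hold. 1. For $\alpha\in V_\alpha$ the layer problem $z'=\tilde f(z,\alpha,0)$ has a hyperbolic limit cycle $\Gamma_\alpha$ of minimal period $T_\alpha$, where $\Gamma_\alpha$ (as a parametrised periodic solution) and $T_\alpha$ are $C^r$ in $\alpha$ (jointly with time, for the solution) and agree with the given ones at $\alpha_*$. Put $\mathcal M:=\bigcup_{\alpha\in V_\alpha}\Gamma_\alpha\times\{\alpha\}$. 2. $S_\Delta:=\Delta\cap\mathcal M=\{(\varphi_0(\alpha),Y(\varphi_0(\alpha),\alpha),\alpha):\alpha\in V_\alpha\}$ for a $C^r$ function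 $\varphi_0:V_\alpha\to V_x$. In the coordinates $(x,\alpha)$ on $\Delta$ write $S_\Delta=\{(\varphi_0(\alpha),\alpha):\alpha\in V_\alpha\}\subset U$. 3. For $|\varepsilon|<\varepsilon_1$ the Poincaré map $\mathcal P_\Delta(\cdot,\varepsilon):U\to W$ is well defined: the orbit of the full system that starts at the point of $\Delta$ with coordinates $(x,\alpha)\in U$ returns to $\Delta$ at a first positive time, at the point with coordinates $\mathcal P_\Delta(x,\alpha,\varepsilon)$. 4. $\mathcal P_\Delta$ is a fast-slow map: it is $C^r$ on $U\times(-\varepsilon_1,\varepsilon_1)$ and has the form $p\mapsto p+h(p)+\varepsilon G(p,\varepsilon)$ with $G$ of class $C^{r-1}$; $h=0$ on $S_\Delta$; and $S_\Delta$ is a connected regularly embedded $C^r$ submanifold of dimension $1<n$. 5. The layer map factorises: $h(p)=N(p)f(p)$ on $U$, with $N(p)\in\mathbb R^{n\times(n-1)}$ and $f(p)\in\mathbb R^{n-1}$ of class $C^r$; $N$ has full column rank on $S_\Delta$; zeros of $h$ outside $S_\Delta$, if any, are isolated; $S_\Delta=\{p\in U:f(p)=0\}$, and $Df$ has full row rank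 on $S_\Delta$. 6. $S_\Delta$ is normally hyperbolic: at each $p\in S_\Delta$ the eigenvalues of $D_p\mathcal P_\Delta(p,0)$, counted with algebraic multiplicity and with one trivial eigenvalue $1$ removed, all lie off the unit circle. -/

import Mathlib

open Set Topology

noncomputable section

/-- The complex eigenvalues of a real linear endomorphism, with algebraic multiplicity. -/
def multipliers {V : Type*} [NormedAddCommGroup V] [NormedSpace ℝ V] [FiniteDimensional ℝ V]
    (A : V →L[ℝ] V) : Multiset ℂ :=
  ((A : V →ₗ[ℝ] V).charpoly).aroots ℂ

open Classical in
/-- The multipliers that remain after `k` copies of the trivial multiplier `1` are removed. -/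
def nontrivialMultipliers {V : Type*} [NormedAddCommGroup V] [NormedSpace ℝ V]
    [FiniteDimensional ℝ V] (k : ℕ) (A : V →L[ℝ] V) : Multiset ℂ :=
  multipliers A - Multiset.replicate k 1

/-! ### Hyperbolic limit cycles -/

/-- `γ` is a non-constant periodic solution of `z' = F z` with minimal period `T`, all of whose
characteristic (Floquet) multipliers, apart from one trivial multiplier `1`, lie off the unit
circle. -/
structure IsHyperbolicLimitCycle {E : Type*} [NormedAddCommGroup E] [NormedSpace ℝ E]
    [FiniteDimensional ℝ E] (F : E → E) (γ : ℝ → E) (T : ℝ) : Prop where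
  period_pos : 0 < T
  solution : ∀ t, HasDerivAt γ (F (γ t)) t
  periodic : ∀ t, γ (t + T) = γ t
  minimal : ∀ t ∈ Ioo 0 T, γ t ≠ γ 0
  /-- `Φ` is the principal fundamental solution of the variational equation along `γ`, and `Φ T`
  is the monodromy operator. -/
  hyperbolic : ∃ Φ : ℝ → (E →L[ℝ] E), Φ 0 = ContinuousLinearMap.id ℝ E ∧
    (∀ t, HasDerivAt Φ ((fderiv ℝ F (γ t)).comp (Φ t)) t) ∧
    ∀ μ ∈ nontrivialMultipliers 1 (Φ T), ‖μ‖ ≠ 1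

/-- The union of the curves `γ α`, each in its own slice, over the parameters `α ∈ Vα`. -/
def cycleManifold {E : Type*} (γ : ℝ → ℝ → E) (Vα : Set ℝ) : Set (E × ℝ) :=
  {p | p.2 ∈ Vα ∧ ∃ t, γ p.2 t = p.1}

/-! ### Cross-sections and first return maps -/

/-- The vector field of the system `z' = f (z, α, ε)`, `α' = ε g (z, α, ε)`. -/
def fastSlowField {E : Type*} (f : E × ℝ × ℝ → E) (g : E × ℝ × ℝ → ℝ) (ε : ℝ) :
    E × ℝ → E × ℝ :=
  fun p => (f (p.1, p.2, ε), ε * g (p.1, p.2, ε))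

/-- The point `(x, Y (x, α), α)` with section coordinates `(x, α)`. -/
def sectionPoint {X : Type*} (Y : X × ℝ → ℝ) (q : X × ℝ) : (X × ℝ) × ℝ :=
  ((q.1, Y q), q.2)

/-- The graph of `y = Y (x, α)` over the coordinate domain `W`. -/
def crossSection {X : Type*} (Y : X × ℝ → ℝ) (W : Set (X × ℝ)) : Set ((X × ℝ) × ℝ) :=
  sectionPoint Y '' W

/-- The solution of `u' = F u` that starts at `p` returns to `Δ` for the first positive time
at the point `p'`. -/
def IsFirstReturn {Z : Type*} [NormedAddCommGroup Z] [NormedSpace ℝ Z] (F : Z → Z) (Δ : Set Z)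
    (p p' : Z) : Prop :=
  ∃ τ > 0, ∃ u : ℝ → Z, u 0 = p ∧
    (∀ t ∈ Icc 0 τ, HasDerivWithinAt u (F (u t)) (Icc 0 τ) t) ∧
    (∀ t ∈ Ioo 0 τ, u t ∉ Δ) ∧ u τ = p' ∧ p' ∈ Δ

/-! ### Fast-slow maps -/

/-- `S` is a `k`-dimensional `C^r` regularly embedded submanifold: locally a regular level set. -/
def IsEmbeddedSubmanifold {V : Type*} [NormedAddCommGroup V] [NormedSpace ℝ V]
    (r : ℕ∞) (k : ℕ) (S : Set V) : Prop :=
  ∃ j : ℕ, Module.finrank ℝ V = k + j ∧ ∀ p ∈ S, ∃ O : Set V, IsOpen O ∧ p ∈ O ∧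
    ∃ ρ : V → EuclideanSpace ℝ (Fin j), ContDiffOn ℝ r ρ O ∧
      (∀ z ∈ O, Function.Surjective (fderiv ℝ ρ z)) ∧ ∀ z ∈ O, z ∈ S ↔ ρ z = 0

/-- The function `h` in the layer map `z ↦ z + h z` of `z ↦ H z ε`. -/
def layerIncrement {V : Type*} [AddGroup V] (H : V → ℝ → V) (z : V) : V :=
  H z 0 - z

/-- `z ↦ H z ε`, for `z ∈ U` and `|ε| < ε₁`, is a `C^r` fast-slow map
`z ↦ z + h z + ε G (z, ε)` whose critical set contains the `k`-dimensional connected regularly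
embedded submanifold `S`, with `k` less than the dimension of the phase space. -/
structure IsFastSlowMap {V : Type*} [NormedAddCommGroup V] [NormedSpace ℝ V]
    (r : ℕ∞) (U : Set V) (ε₁ : ℝ) (H : V → ℝ → V) (k : ℕ) (S : Set V) : Prop where
  smooth : ContDiffOn ℝ r (fun p : V × ℝ => H p.1 p.2) (U ×ˢ Ioo (-ε₁) ε₁)
  expansion : ∃ G : V → ℝ → V,
    ContDiffOn ℝ (r - 1 : ℕ∞) (fun p : V × ℝ => G p.1 p.2) (U ×ˢ Ioo (-ε₁) ε₁) ∧
    ∀ z ∈ U, ∀ ε ∈ Ioo (-ε₁) ε₁, H z ε = z + layerIncrement H z + ε • G z ε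
  subset : S ⊆ U
  fixed : ∀ z ∈ S, layerIncrement H z = 0
  dim_lt : k < Module.finrank ℝ V
  submanifold : IsEmbeddedSubmanifold r k S
  connected : IsConnected S

/-- On `U` the function `h` factorises as `h z = N z (f z)`, where `N z` is a matrix of size
`n × (n - k)` and `f z` a column of length `n - k`. On `S` the matrix `N z` has full column rank,
zeros of `h` outside `S` are isolated, and `S` is the regular level set `f = 0`. -/
def HasFactorisation {V : Type*} [NormedAddCommGroup V] [NormedSpace ℝ V]
    (r : ℕ∞) (U : Set V) (h : V → V) (k : ℕ) (S : Set V) : Prop :=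
  ∃ j : ℕ, Module.finrank ℝ V = k + j ∧
    ∃ (N : V → (EuclideanSpace ℝ (Fin j) →L[ℝ] V)) (f : V → EuclideanSpace ℝ (Fin j)),
      ContDiffOn ℝ r N U ∧ ContDiffOn ℝ r f U ∧
      (∀ z ∈ U, h z = N z (f z)) ∧
      (∀ z ∈ S, Function.Injective (N z)) ∧
      (∀ z ∈ U, z ∉ S → h z = 0 → ∃ O ∈ 𝓝 z, ∀ w ∈ O ∩ U, h w = 0 → w = z) ∧
      S = {z ∈ U | f z = 0} ∧
      ∀ z ∈ S, Function.Surjective (fderiv ℝ f z)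

/-- At every point of the `k`-dimensional critical manifold `S`, the non-trivial multipliers of
the layer map lie off the unit circle. -/
def IsNormallyHyperbolic {V : Type*} [NormedAddCommGroup V] [NormedSpace ℝ V]
    [FiniteDimensional ℝ V] (H : V → ℝ → V) (k : ℕ) (S : Set V) : Prop :=
  ∀ z ∈ S, ∀ μ ∈ nontrivialMultipliers k (fderiv ℝ (fun w => H w 0) z), ‖μ‖ ≠ 1

end

/-!
The layer problem, its perturbation and the parameters `α`, `ε` are combined into one autonomous
system on `(z, α, ε)`-space, which a cutoff replaces by a complete one with the same orbits near the
given cycle (`exists_truncation`). Everything then rests on the fact that the flow of a Lipschitz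
`C^r` vector field is jointly `C^r` (`IsGlobalFlow.contDiff`). This is obtained from the implicit
function theorem for the integral equation in the space of paths, where superposition with a `C^r`
map is a `C^r` operator (`contDiff_superposition`); time enters through the rescaled equation
`u' = τ F(u)` on the unit interval, so that smoothness in time needs no separate argument.

By transversality, the implicit function theorem gives a `C^r` time at which orbits starting near
the base point cross the section again, and the minimality of the period together with compactness
makes it the first return time over a small piece `W` of the section (`exists_firstReturnTime`,
`exists_returnMap`). The layer map has the form `(x, α) ↦ (Pₓ(x, α), α)`, and the monodromy operator
of a closed orbit is, in a basis adapted to the section and to the flow direction, block triangular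
with blocks `D_x Pₓ` and `1` (`charpoly_monodromy`). Hence hyperbolicity of the given cycle says that
`D_x Pₓ` has no eigenvalue on the unit circle. In particular `1` is not an eigenvalue, so
`Pₓ(x, α) = x` can be solved for `x = φ(α)`; these fixed points are the closed orbits near the given
one. Since the absence of eigenvalues on the unit circle is an open condition
(`eventually_multipliers_off_circle`), these orbits are hyperbolic for `α` near `α_*`, and the same
eigenvalues give the normal hyperbolicity of the graph of `φ`. The layer increment factorises
through its `x`-component `Pₓ(x, α) - x`, and the expansion in `ε` is Hadamard's lemma.
-/

universe u

/-! ### Superposition operators -/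

theorem continuousMap_pairing_bound {K E G : Type*} [TopologicalSpace K] [CompactSpace K]
    [NormedAddCommGroup E] [NormedSpace ℝ E] [NormedAddCommGroup G] [NormedSpace ℝ G]
    (A : C(K, E →L[ℝ] G)) (u : C(K, E)) (t : K) : ‖A t (u t)‖ ≤ 1 * ‖A‖ * ‖u‖ := by
  rw [one_mul]
  exact ((A t).le_opNorm _).trans
    (mul_le_mul (A.norm_coe_le_norm t) (u.norm_coe_le_norm t) (norm_nonneg _) (norm_nonneg A))

/-- The bounded bilinear pairing `(A, u) ↦ (t ↦ A t (u t))` of operator-valued and vector-valued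
continuous functions on a compact space, curried in `A`. -/
noncomputable def pointwiseApply (K E G : Type*) [TopologicalSpace K] [CompactSpace K]
    [NormedAddCommGroup E] [NormedSpace ℝ E] [NormedAddCommGroup G] [NormedSpace ℝ G] :
    C(K, E →L[ℝ] G) →L[ℝ] C(K, E) →L[ℝ] C(K, G) :=
  LinearMap.mkContinuous₂
    (LinearMap.mk₂ ℝ (fun (A : C(K, E →L[ℝ] G)) (u : C(K, E)) =>
        (⟨fun t => A t (u t), by fun_prop⟩ : C(K, G)))
      (fun _ _ _ => by ext; simp) (fun _ _ _ => by ext; simp)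
      (fun _ _ _ => by ext; simp) (fun _ _ _ => by ext; simp)) 1
    (fun A u => (ContinuousMap.norm_le _ (by positivity)).2
      (fun t => continuousMap_pairing_bound A u t))

/-- The superposition operator `u ↦ F ∘ u` on continuous functions. -/
def superposition (K : Type*) {E G : Type*} [TopologicalSpace K] [TopologicalSpace E]
    [TopologicalSpace G] (F : E → G) (hF : Continuous F) (u : C(K, E)) : C(K, G) :=
  (⟨F, hF⟩ : C(E, G)).comp u

@[simp]
theorem superposition_apply {K E G : Type*} [TopologicalSpace K] [TopologicalSpace E]
    [TopologicalSpace G] (F : E → G) (hF : Continuous F) (u : C(K, E)) (t : K) :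
    superposition K F hF u t = F (u t) := rfl

theorem continuous_superposition {K E G : Type*} [TopologicalSpace K] [TopologicalSpace E]
    [TopologicalSpace G] (F : E → G) (hF : Continuous F) : Continuous (superposition K F hF) :=
  ContinuousMap.continuous_postcomp _

/-- The derivative of the superposition operator acts pointwise. The uniformity in `t` of the
linear approximation comes from the continuity of the superposition operator of `fderiv ℝ F`. -/
theorem hasFDerivAt_superposition {K E G : Type*} [TopologicalSpace K] [CompactSpace K]
    [NormedAddCommGroup E] [NormedSpace ℝ E] [NormedAddCommGroup G] [NormedSpace ℝ G]
    {F : E → G} (hF : ContDiff ℝ 1 F) (u : C(K, E)) :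
    HasFDerivAt (superposition K F hF.continuous)
      (pointwiseApply K E G (superposition K (fderiv ℝ F) (hF.continuous_fderiv one_ne_zero) u)) u := by
  rw [hasFDerivAt_iff_isLittleO, Asymptotics.isLittleO_iff]
  intro c hc
  have hcont := (continuous_superposition (K := K) (fderiv ℝ F)
    (hF.continuous_fderiv one_ne_zero)).continuousAt (x := u)
  obtain ⟨δ, hδ, hδc⟩ := (Metric.continuousAt_iff (α := C(K, E)) (β := C(K, E →L[ℝ] G))).1 hcont c hc
  filter_upwards [Metric.ball_mem_nhds u hδ] with v hv
  refine (ContinuousMap.norm_le _ (by positivity)).2 fun t => ?_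
  have hball : ∀ y ∈ Metric.ball (u t) δ, ‖fderiv ℝ F y - fderiv ℝ F (u t)‖ ≤ c := by
    intro y hy
    -- translate `u` by a constant so that it passes through `y`
    have h1 : dist (u + ContinuousMap.const K (y - u t)) u < δ := by
      rw [dist_eq_norm, add_sub_cancel_left]
      refine lt_of_le_of_lt ((ContinuousMap.norm_le _ (norm_nonneg (y - u t))).2 fun s => ?_)
        (by simpa [dist_eq_norm] using hy)
      simp
    have h2 := (ContinuousMap.dist_apply_le_dist t).trans (hδc h1).le
    simpa [dist_eq_norm] using h2
  have hvt : v t ∈ Metric.ball (u t) δ :=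
    lt_of_le_of_lt (ContinuousMap.dist_apply_le_dist t) hv
  have := (convex_ball (u t) δ).norm_image_sub_le_of_norm_fderiv_le' (𝕜 := ℝ)
    (fun y _ => (hF.differentiable one_ne_zero).differentiableAt) hball
    (Metric.mem_ball_self hδ) hvt
  refine this.trans (mul_le_mul_of_nonneg_left ?_ hc.le)
  exact (v - u).norm_coe_le_norm t

theorem contDiff_superposition_nat {K : Type*} [TopologicalSpace K] [CompactSpace K] (n : ℕ) :
    ∀ {E G : Type u} [NormedAddCommGroup E] [NormedSpace ℝ E] [NormedAddCommGroup G]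
      [NormedSpace ℝ G] {F : E → G} (hF : ContDiff ℝ n F),
      ContDiff ℝ n (superposition K F hF.continuous) := by
  induction n with
  | zero =>
    intro E G _ _ _ _ F hF
    exact contDiff_zero.2 (continuous_superposition F hF.continuous)
  | succ n ih =>
    intro E G _ _ _ _ F hF
    have h1 : ContDiff ℝ 1 F := hF.of_le (by exact_mod_cast Nat.le_add_left 1 n)
    have hd : ContDiff ℝ n (fderiv ℝ F) := by
      have := hF
      push_cast at this
      exact (contDiff_succ_iff_fderiv.1 this).2.2
    push_cast
    refine contDiff_succ_iff_fderiv.2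
      ⟨fun u => (hasFDerivAt_superposition h1 u).differentiableAt, by simp, ?_⟩
    have : fderiv ℝ (superposition K F hF.continuous) =
        fun u => pointwiseApply K E G (superposition K (fderiv ℝ F) hd.continuous u) :=
      funext fun u => (hasFDerivAt_superposition h1 u).fderiv
    rw [this]
    exact (pointwiseApply K E G).contDiff.comp (ih hd)

/-- Superposition with a `C^n` map is a `C^n` operator on continuous functions. -/
theorem contDiff_superposition {K : Type*} [TopologicalSpace K] [CompactSpace K] {n : ℕ∞}
    {E G : Type u} [NormedAddCommGroup E] [NormedSpace ℝ E] [NormedAddCommGroup G]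
    [NormedSpace ℝ G] {F : E → G} (hF : ContDiff ℝ n F) :
    ContDiff ℝ n (superposition K F hF.continuous) := by
  rw [contDiff_iff_forall_nat_le]
  intro k hk
  exact contDiff_superposition_nat k (hF.of_le (by exact_mod_cast hk))

/-! ### Primitives and parametric integrals -/

/-- The primitive `t ↦ ∫ s in 0..t, u s` of a continuous function on the unit interval. -/
noncomputable def primitive {E : Type*} [NormedAddCommGroup E] [NormedSpace ℝ E] :
    C(unitInterval, E) →L[ℝ] C(unitInterval, E) :=
  LinearMap.mkContinuous
    { toFun := fun u => ⟨fun t => ∫ s in (0 : ℝ)..t, IccExtend zero_le_one u s, by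
        have h : Continuous fun t : ℝ => ∫ s in (0 : ℝ)..t, IccExtend zero_le_one u s :=
          intervalIntegral.continuous_primitive
            (fun _ _ => (u.continuous.Icc_extend' (h := zero_le_one)).intervalIntegrable _ _) 0
        exact h.comp continuous_subtype_val⟩
      map_add' := fun u v => by
        ext t
        exact intervalIntegral.integral_add
          ((u.continuous.Icc_extend' (h := zero_le_one)).intervalIntegrable _ _)
          ((v.continuous.Icc_extend' (h := zero_le_one)).intervalIntegrable _ _)
      map_smul' := fun c u => by
        ext t
        exact intervalIntegral.integral_smul c _ } 1
    (fun u => by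
      rw [one_mul]
      refine (ContinuousMap.norm_le _ (norm_nonneg _)).2 fun t => ?_
      have := intervalIntegral.norm_integral_le_of_norm_le_const (a := 0) (b := (t : ℝ))
        (f := IccExtend zero_le_one u) (C := ‖u‖) (fun s _ => u.norm_coe_le_norm _)
      refine this.trans ?_
      have h1 : |(t : ℝ) - 0| ≤ 1 := by
        rw [sub_zero, abs_of_nonneg t.2.1]; exact t.2.2
      nlinarith [norm_nonneg u])

theorem primitive_apply {E : Type*} [NormedAddCommGroup E] [NormedSpace ℝ E]
    (u : C(unitInterval, E)) (t : unitInterval) :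
    primitive u t = ∫ s in (0 : ℝ)..t, IccExtend zero_le_one u s := rfl

theorem norm_primitive_le {E : Type*} [NormedAddCommGroup E] [NormedSpace ℝ E] :
    ‖(primitive : C(unitInterval, E) →L[ℝ] C(unitInterval, E))‖ ≤ 1 :=
  LinearMap.mkContinuous_norm_le _ zero_le_one _

/-- Integration over a compact interval of a jointly `C^n` function gives a `C^n` function of the
parameter, because the integrand depends on it through a superposition operator. -/
theorem contDiff_integral_param {n : ℕ∞} {E G : Type u} [NormedAddCommGroup E] [NormedSpace ℝ E]
    [NormedAddCommGroup G] [NormedSpace ℝ G] {k : E × ℝ → G} (hk : ContDiff ℝ n k) :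
    ContDiff ℝ n fun p => ∫ s in (0 : ℝ)..1, k (p, s) := by
  let L : E →L[ℝ] C(unitInterval, E × ℝ) :=
    LinearMap.mkContinuous
      { toFun := fun p => ContinuousMap.const _ (p, 0)
        map_add' := fun p q => by ext <;> simp
        map_smul' := fun c p => by ext <;> simp } 1
      (fun p => by
        rw [one_mul]
        exact (ContinuousMap.norm_le _ (norm_nonneg p)).2 fun t => by simp)
  let c : C(unitInterval, E × ℝ) := ⟨fun s => (0, s), by fun_prop⟩
  let e : C(unitInterval, G) →L[ℝ] G := ContinuousMap.evalCLM ℝ (1 : unitInterval)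
  have h0 : ContDiff ℝ n fun p : E => superposition unitInterval k hk.continuous (L p + c) :=
    (contDiff_superposition hk).comp (L.contDiff.add contDiff_const)
  have h1 : ContDiff ℝ n fun p : E =>
      e (primitive (superposition unitInterval k hk.continuous (L p + c))) :=
    e.contDiff.comp ((primitive (E := G)).contDiff.comp h0)
  convert h1 using 2 with p
  change _ = primitive _ (1 : unitInterval)
  rw [primitive_apply]
  refine intervalIntegral.integral_congr fun s hs => ?_
  have hs' : s ∈ Icc (0 : ℝ) 1 := by simpa using hs
  simp [IccExtend_of_mem _ _ hs', L, c]

/-! ### Smooth dependence of flows on initial values -/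

/-- A bounded Lipschitz vector field has global integral curves. -/
theorem exists_global_integralCurve {E : Type*} [NormedAddCommGroup E] [NormedSpace ℝ E]
    [CompleteSpace E] {F : E → E} {K M : NNReal} (hK : LipschitzWith K F) (hM : ∀ x, ‖F x‖ ≤ M)
    (x : E) : ∃ γ : ℝ → E, γ 0 = x ∧ ∀ t, HasDerivAt γ (F (γ t)) t := by
  have hloc : ∀ T : NNReal, ∃ γ : ℝ → E, γ 0 = x ∧ ∀ t ∈ Icc (-T : ℝ) T,
      HasDerivWithinAt γ (F (γ t)) (Icc (-T : ℝ) T) t := by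
    intro T
    have hT : (0 : ℝ) ∈ Icc (-T : ℝ) T := ⟨by simp, T.2⟩
    have hpl : IsPicardLindelof (fun _ => F) (⟨0, hT⟩ : Icc (-T : ℝ) T) x (M * T) 0 M K :=
      IsPicardLindelof.of_time_independent (fun y _ => hM y) hK.lipschitzOnWith (by simp)
    exact hpl.exists_eq_forall_mem_Icc_hasDerivWithinAt₀
  choose γ hγ0 hγ using hloc
  have hderiv : ∀ (T : NNReal) (t : ℝ), |t| < T → HasDerivAt (γ T) (F (γ T t)) t := by
    intro T t ht
    exact (hγ T t (abs_le.1 ht.le)).hasDerivAt (Icc_mem_nhds (abs_lt.1 ht).1 (abs_lt.1 ht).2)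
  have hagree : ∀ (S T : NNReal) (t : ℝ), |t| < S → |t| < T → γ S t = γ T t := by
    intro S T t hS hT
    set R : ℝ := min S T
    have hR : |t| < R := lt_min hS hT
    have h0 : 0 < R := (abs_nonneg t).trans_lt hR
    have hd : ∀ (U : NNReal), R ≤ U → ∀ s ∈ Ioo (-R) R, HasDerivAt (γ U) (F (γ U s)) s ∧
        γ U s ∈ (univ : Set E) := fun U hU s hs =>
      ⟨hderiv U s ((abs_lt.2 hs).trans_le hU), mem_univ _⟩
    exact ODE_solution_unique_of_mem_Ioo (v := fun _ => F) (s := fun _ => univ) (K := K)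
      (fun _ _ => hK.lipschitzOnWith) (t₀ := 0) ⟨by linarith, h0⟩ (hd S (min_le_left _ _))
      (hd T (min_le_right _ _)) (by rw [hγ0, hγ0]) (abs_lt.1 hR)
  let T : ℝ → NNReal := fun t => ⟨|t| + 1, by positivity⟩
  refine ⟨fun t => γ (T t) t, hγ0 _, fun t => ?_⟩
  have ht : |t| < T t := lt_add_one _
  refine (hderiv (T t) t ht).congr_of_eventuallyEq ?_
  filter_upwards [continuous_abs.continuousAt.eventually_lt continuousAt_const ht] with s hs
  exact hagree _ _ _ (lt_add_one _) hs

/-- `φ` is the global flow of the autonomous vector field `F`. -/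
structure IsGlobalFlow {E : Type*} [NormedAddCommGroup E] [NormedSpace ℝ E] (F : E → E)
    (φ : ℝ → E → E) : Prop where
  map_zero : ∀ x, φ 0 x = x
  hasDerivAt : ∀ t x, HasDerivAt (fun s => φ s x) (F (φ t x)) t

namespace IsGlobalFlow

variable {E : Type*} [NormedAddCommGroup E] [NormedSpace ℝ E] {F : E → E} {φ : ℝ → E → E}
  {K : NNReal}

theorem eq_of_integralCurve (hφ : IsGlobalFlow F φ) (hK : LipschitzWith K F) {γ : ℝ → E}
    (hγ : ∀ t, HasDerivAt γ (F (γ t)) t) (t : ℝ) : φ t (γ 0) = γ t :=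
  congrFun (ODE_solution_unique_univ (v := fun _ => F) (s := fun _ => univ) (K := K) (t₀ := 0)
    (fun _ => hK.lipschitzOnWith) (fun t => ⟨hφ.hasDerivAt t _, mem_univ _⟩)
    (fun t => ⟨hγ t, mem_univ _⟩) (hφ.map_zero _)) t

theorem map_add (hφ : IsGlobalFlow F φ) (hK : LipschitzWith K F) (s t : ℝ) (x : E) :
    φ (s + t) x = φ s (φ t x) := by
  have h := hφ.eq_of_integralCurve hK (γ := fun s => φ (s + t) x)
    (fun s => (hφ.hasDerivAt (s + t) x).comp_add_const s t) s
  simpa using h.symm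

end IsGlobalFlow

/-- The map `((x, τ), u) ↦ u - x - τ ∫ F(u)` on paths over the unit interval; its zeros are the
integral curves `s ↦ φ (τ s) x`, with time rescaled. -/
noncomputable def integralEquation {E : Type*} [NormedAddCommGroup E] [NormedSpace ℝ E]
    (F : E → E) (hF : Continuous F) (p : (E × ℝ) × C(unitInterval, E)) : C(unitInterval, E) :=
  p.2 - ContinuousMap.const _ p.1.1 - p.1.2 • primitive (superposition unitInterval F hF p.2)

theorem contDiff_const_continuousMap {K E : Type*} [TopologicalSpace K] [CompactSpace K]
    [NormedAddCommGroup E] [NormedSpace ℝ E] {n : WithTop ℕ∞} :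
    ContDiff ℝ n (fun x : E => (ContinuousMap.const K x : C(K, E))) := by
  let L : E →L[ℝ] C(K, E) :=
    LinearMap.mkContinuous
      { toFun := fun p => ContinuousMap.const _ p
        map_add' := fun p q => by ext; simp
        map_smul' := fun c p => by ext; simp } 1
      (fun p => by
        rw [one_mul]
        exact (ContinuousMap.norm_le _ (norm_nonneg p)).2 fun t => by simp)
  exact L.contDiff

theorem contDiff_integralEquation {E : Type u} [NormedAddCommGroup E] [NormedSpace ℝ E] {r : ℕ∞}
    {F : E → E} (hF : ContDiff ℝ r F) : ContDiff ℝ r (integralEquation F hF.continuous) := by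
  unfold integralEquation
  have h1 : ContDiff ℝ r fun p : (E × ℝ) × C(unitInterval, E) =>
      primitive (superposition unitInterval F hF.continuous p.2) :=
    (primitive (E := E)).contDiff.comp ((contDiff_superposition hF).comp contDiff_snd)
  have h2 : ContDiff ℝ r fun p : (E × ℝ) × C(unitInterval, E) =>
      (ContinuousMap.const unitInterval p.1.1 : C(unitInterval, E)) :=
    contDiff_const_continuousMap.comp contDiff_fst.fst
  exact (contDiff_snd.sub h2).sub (contDiff_fst.snd.smul h1)

theorem ContinuousLinearMap.isInvertible_id_sub {V : Type*} [NormedAddCommGroup V]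
    [NormedSpace ℝ V] [CompleteSpace V] {A : V →L[ℝ] V} (hA : ‖A‖ < 1) :
    (ContinuousLinearMap.id ℝ V - A).IsInvertible := by
  obtain ⟨w, hw⟩ := isUnit_one_sub_of_norm_lt_one hA
  exact ⟨ContinuousLinearEquiv.unitsEquiv ℝ _ w, by ext1 v; exact congrArg (fun A => A v) hw⟩

theorem ContinuousLinearMap.norm_smul_comp_lt_one {V : Type*} [NormedAddCommGroup V]
    [NormedSpace ℝ V] {A B : V →L[ℝ] V} {τ k : ℝ} (hA : ‖A‖ ≤ 1) (hB : ‖B‖ ≤ k)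
    (hτ : |τ| * k < 1) : ‖τ • A.comp B‖ < 1 := by
  rw [norm_smul, Real.norm_eq_abs]
  refine lt_of_le_of_lt (mul_le_mul_of_nonneg_left ?_ (abs_nonneg τ)) hτ
  refine (A.opNorm_comp_le B).trans ?_
  calc _ ≤ 1 * k := mul_le_mul hA hB (norm_nonneg _) zero_le_one
    _ = k := one_mul _

theorem isInvertible_fderiv_integralEquation {E : Type u} [NormedAddCommGroup E] [NormedSpace ℝ E]
    [CompleteSpace E] {F : E → E} (hF : ContDiff ℝ 1 F) {K : NNReal} (hK : LipschitzWith K F)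
    {τ : ℝ} (hτ : |τ| * K < 1) (x : E) (u : C(unitInterval, E)) :
    (fderiv ℝ (integralEquation F hF.continuous) ((x, τ), u) ∘L
      .inr ℝ (E × ℝ) C(unitInterval, E)).IsInvertible := by
  set B : C(unitInterval, E) →L[ℝ] C(unitInterval, E) :=
    pointwiseApply unitInterval E E
      (superposition unitInterval (fderiv ℝ F) (hF.continuous_fderiv one_ne_zero) u) with hB
  have h1 : HasFDerivAt (fun v => integralEquation F hF.continuous ((x, τ), v))
      (ContinuousLinearMap.id ℝ _ - τ • (primitive (E := E)).comp B) u := by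
    have h := (primitive (E := E)).hasFDerivAt.comp u (hasFDerivAt_superposition hF u)
    exact ((hasFDerivAt_id u).sub_const (ContinuousMap.const _ x)).sub (h.const_smul τ)
  have h2 : HasFDerivAt (fun v => integralEquation F hF.continuous ((x, τ), v))
      (fderiv ℝ (integralEquation F hF.continuous) ((x, τ), u) ∘L
        .inr ℝ (E × ℝ) C(unitInterval, E)) u := by
    have hd := (contDiff_integralEquation (r := 1) (by exact_mod_cast hF)).differentiable
      (by simp) |>.differentiableAt (x := ((x, τ), u))
    exact hd.hasFDerivAt.comp u (hasFDerivAt_prodMk_right (x, τ) u)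
  rw [h2.unique h1]
  have hBn : ‖B‖ ≤ K := by
    refine B.opNorm_le_bound K.2 fun v => (ContinuousMap.norm_le _ (by positivity)).2 fun t => ?_
    refine ((fderiv ℝ F (u t)).le_opNorm (v t)).trans ?_
    exact mul_le_mul (norm_fderiv_le_of_lipschitz ℝ hK) (v.norm_coe_le_norm t) (norm_nonneg _) K.2
  exact ContinuousLinearMap.isInvertible_id_sub
    (ContinuousLinearMap.norm_smul_comp_lt_one norm_primitive_le hBn hτ)

namespace IsGlobalFlow

variable {E : Type u} [NormedAddCommGroup E] [NormedSpace ℝ E] {F : E → E} {φ : ℝ → E → E}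
  {K : NNReal}

/-- The rescaled orbit segment `s ↦ φ (τ s) x` over the unit interval. -/
def orbitSegment (hφ : IsGlobalFlow F φ) (τ : ℝ) (x : E) : C(unitInterval, E) :=
  ⟨fun s => φ (τ * s) x, by
    have h : Continuous fun t => φ t x :=
      continuous_iff_continuousAt.2 fun t => (hφ.hasDerivAt t x).continuousAt
    exact h.comp (by fun_prop)⟩

theorem hasDerivAt_rescaled (hφ : IsGlobalFlow F φ) (τ : ℝ) (x : E) (s : ℝ) :
    HasDerivAt (fun s => φ (τ * s) x) (τ • F (φ (τ * s) x)) s := by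
  have h := (hφ.hasDerivAt (τ * s) x).scomp s ((hasDerivAt_id s).const_mul τ)
  rw [mul_one] at h
  exact h

variable [CompleteSpace E]

theorem integralEquation_orbitSegment (hφ : IsGlobalFlow F φ) (hF : Continuous F) (τ : ℝ) (x : E) :
    integralEquation F hF ((x, τ), hφ.orbitSegment τ x) = 0 := by
  ext s
  have hc : Continuous fun s : ℝ => τ • F (φ (τ * s) x) :=
    (hF.comp (continuous_iff_continuousAt.2
      fun t => (hφ.hasDerivAt_rescaled τ x t).continuousAt)).const_smul τ
  have h1 := intervalIntegral.integral_eq_sub_of_hasDerivAt (a := 0) (b := (s : ℝ))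
    (fun t _ => hφ.hasDerivAt_rescaled τ x t) (hc.intervalIntegrable _ _)
  have h2 : ∫ t in (0 : ℝ)..s, IccExtend zero_le_one
      (superposition unitInterval F hF (hφ.orbitSegment τ x)) t =
      ∫ t in (0 : ℝ)..s, F (φ (τ * t) x) := by
    refine intervalIntegral.integral_congr fun t ht => ?_
    rw [uIcc_of_le s.2.1] at ht
    have ht' : t ∈ Icc (0 : ℝ) 1 := ⟨ht.1, ht.2.trans s.2.2⟩
    simp [IccExtend_of_mem _ _ ht', orbitSegment]
  rw [intervalIntegral.integral_smul, mul_zero, hφ.map_zero] at h1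
  change φ (τ * s) x - x - τ • ∫ t in (0 : ℝ)..s, IccExtend zero_le_one
      (superposition unitInterval F hF (hφ.orbitSegment τ x)) t = 0
  rw [h2, h1, sub_self]

theorem eq_orbitSegment_of_integralEquation (hφ : IsGlobalFlow F φ) (hK : LipschitzWith K F)
    {τ : ℝ} {x : E} {u : C(unitInterval, E)}
    (hu : integralEquation F hK.continuous ((x, τ), u) = 0) : u 1 = φ τ x := by
  let w : ℝ → E := fun s => x + τ • ∫ σ in (0 : ℝ)..s, F (IccExtend zero_le_one u σ)
  have hc : Continuous fun s => F (IccExtend zero_le_one u s) :=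
    hK.continuous.comp (u.continuous.Icc_extend' (h := zero_le_one))
  have hw : ∀ s, HasDerivAt w (τ • F (IccExtend zero_le_one u s)) s := fun s =>
    ((hc.integral_hasStrictDerivAt 0 s).hasDerivAt.const_smul τ).const_add x
  have huw : ∀ s : unitInterval, u s = w s := by
    intro s
    have h := congrArg (fun v : C(unitInterval, E) => v s) hu
    change u s - x - τ • ∫ σ in (0 : ℝ)..s, F (IccExtend zero_le_one u σ) = 0 at h
    rwa [sub_sub, sub_eq_zero] at h
  have hlip : LipschitzWith (‖τ‖₊ * K) fun y => τ • F y := by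
    exact (lipschitzWith_smul τ).comp hK
  have h := ODE_solution_unique (v := fun _ y => τ • F y) (f := w) (g := fun s => φ (τ * s) x)
    (a := 0) (b := 1) (K := ‖τ‖₊ * K) (fun _ => hlip)
    (fun s _ => (hw s).continuousAt.continuousWithinAt)
    (fun s hs => by
      have hs' : s ∈ Icc (0 : ℝ) 1 := ⟨hs.1, hs.2.le⟩
      have h3 := (hw s).hasDerivWithinAt (s := Ici s)
      rwa [IccExtend_of_mem _ _ hs', huw ⟨s, hs'⟩] at h3)
    (fun s _ => (hφ.hasDerivAt_rescaled τ x s).continuousAt.continuousWithinAt)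
    (fun s _ => (hφ.hasDerivAt_rescaled τ x s).hasDerivWithinAt)
    (by simp [w, hφ.map_zero]) (right_mem_Icc.2 zero_le_one)
  have h1 := huw 1
  rw [h1]
  simpa using h

theorem contDiffAt_of_small_time (hφ : IsGlobalFlow F φ) {r : ℕ∞} (hr : 1 ≤ r)
    (hF : ContDiff ℝ r F) (hK : LipschitzWith K F) {τ : ℝ} (hτ : |τ| * K < 1) (x : E) :
    ContDiffAt ℝ r (fun p : ℝ × E => φ p.1 p.2) (τ, x) := by
  have hr0 : (r : WithTop ℕ∞) ≠ 0 := by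
    have : r ≠ 0 := (zero_lt_one.trans_le hr).ne'
    exact_mod_cast this
  have hF1 : ContDiff ℝ 1 F := hF.of_le (by exact_mod_cast hr)
  have hcd := (contDiff_integralEquation hF).contDiffAt (x := ((x, τ), hφ.orbitSegment τ x))
  have hinv := isInvertible_fderiv_integralEquation hF1 hK hτ x (hφ.orbitSegment τ x)
  have h1 := hcd.contDiffAt_implicitFunction hr0 hinv
  have h2 := hcd.eventually_apply_implicitFunction hr0 hinv
  set ψ := hcd.implicitFunction hr0 hinv
  have h3 : ContDiffAt ℝ r (fun p : E × ℝ => ψ p 1) (x, τ) :=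
    (ContinuousMap.evalCLM ℝ (M := E) (1 : unitInterval)).contDiff.contDiffAt.comp (x, τ) h1
  have h4 : (fun p : E × ℝ => ψ p 1) =ᶠ[𝓝 (x, τ)] fun p => φ p.2 p.1 := by
    filter_upwards [h2] with p hp
    rw [hφ.integralEquation_orbitSegment] at hp
    exact hφ.eq_orbitSegment_of_integralEquation hK hp
  have h5 : ContDiffAt ℝ r (fun p : E × ℝ => φ p.2 p.1) (x, τ) := h3.congr_of_eventuallyEq h4.symm
  exact h5.comp (τ, x) (f := fun p : ℝ × E => (p.2, p.1)) (by fun_prop)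

/-- The flow of a Lipschitz `C^r` vector field is jointly `C^r`: for small times by the implicit
function theorem in the space of paths, for all times by repeated doubling. -/
theorem contDiff (hφ : IsGlobalFlow F φ) {r : ℕ∞} (hr : 1 ≤ r)
    (hF : ContDiff ℝ r F) (hK : LipschitzWith K F) :
    ContDiff ℝ r (fun p : ℝ × E => φ p.1 p.2) := by
  have key : ∀ n : ℕ, ∀ (τ : ℝ) (x : E), |τ| * K < 2 ^ n →
      ContDiffAt ℝ r (fun p : ℝ × E => φ p.1 p.2) (τ, x) := by
    intro n
    induction n with
    | zero => exact fun τ x h => hφ.contDiffAt_of_small_time hr hF hK (by simpa using h) x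
    | succ n ih =>
      intro τ x h
      have h' : |τ / 2| * K < 2 ^ n := by
        rw [abs_div, abs_two]
        rw [pow_succ] at h
        linarith
      have h1 : ContDiffAt ℝ r (fun p : ℝ × E => φ (p.1 / 2) p.2) (τ, x) :=
        (ih (τ / 2) x h').comp (τ, x) (f := fun p : ℝ × E => (p.1 / 2, p.2)) (by fun_prop)
      have h2 : ContDiffAt ℝ r (fun p : ℝ × E => φ (p.1 / 2) (φ (p.1 / 2) p.2)) (τ, x) :=
        (ih (τ / 2) (φ (τ / 2) x) h').comp (τ, x)
          (f := fun p : ℝ × E => (p.1 / 2, φ (p.1 / 2) p.2))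
          ((by fun_prop : ContDiffAt ℝ r (fun p : ℝ × E => p.1 / 2) (τ, x)).prodMk h1)
      refine h2.congr_of_eventuallyEq (Filter.Eventually.of_forall fun p => ?_)
      simp only [← hφ.map_add hK, add_halves]
  refine contDiff_iff_contDiffAt.2 fun p => ?_
  obtain ⟨n, hn⟩ := pow_unbounded_of_one_lt (|p.1| * K) one_lt_two
  exact key n p.1 p.2 hn

/-- The spatial derivative of the flow solves the variational equation. -/
theorem hasDerivAt_fderiv [FiniteDimensional ℝ E] (hφ : IsGlobalFlow F φ) (hF : ContDiff ℝ 1 F)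
    (hφ1 : ContDiff ℝ 1 (fun p : ℝ × E => φ p.1 p.2)) (t : ℝ) (x : E) :
    HasDerivAt (fun t => fderiv ℝ (φ t) x) ((fderiv ℝ F (φ t x)).comp (fderiv ℝ (φ t) x)) t := by
  have hd : ∀ s y, HasFDerivAt (φ s)
      ((fderiv ℝ (fun p : ℝ × E => φ p.1 p.2) (s, y)).comp (.inr ℝ ℝ E)) y := fun s y =>
    ((hφ1.differentiable one_ne_zero).differentiableAt.hasFDerivAt (x := (s, y))).comp y
      (hasFDerivAt_prodMk_right s y)
  let A : ℝ → E → E →L[ℝ] E := fun s y => (fderiv ℝ F (φ s y)).comp (fderiv ℝ (φ s) y)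
  have hAc : Continuous fun p : ℝ × E => A p.1 p.2 := by
    have h1 : Continuous fun p : ℝ × E => fderiv ℝ (φ p.1) p.2 := by
      simp_rw [fun p : ℝ × E => (hd p.1 p.2).fderiv]
      exact (hφ1.continuous_fderiv one_ne_zero).clm_comp continuous_const
    exact ((hF.continuous_fderiv one_ne_zero).comp hφ1.continuous).clm_comp h1
  have hAx : Continuous fun s => A s x := hAc.comp (by fun_prop : Continuous fun s => (s, x))
  have hFφ : ∀ y, Continuous fun s => F (φ s y) := fun y =>
    hF.continuous.comp (hφ1.continuous.comp (by fun_prop : Continuous fun s => (s, y)))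
  have hint : ∀ s y, φ s y = y + ∫ σ in (0 : ℝ)..s, F (φ σ y) := by
    intro s y
    rw [intervalIntegral.integral_eq_sub_of_hasDerivAt (fun σ _ => hφ.hasDerivAt σ y)
      ((hFφ y).intervalIntegrable _ _), hφ.map_zero]
    abel
  have hAint : ∀ s, fderiv ℝ (φ s) x =
      ContinuousLinearMap.id ℝ E + ∫ σ in (0 : ℝ)..s, A σ x := by
    intro s
    obtain ⟨C, hC⟩ := ((isCompact_uIcc (a := (0 : ℝ)) (b := s)).prod
      (isCompact_closedBall x 1)).exists_bound_of_continuousOn hAc.continuousOn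
    have h := intervalIntegral.hasFDerivAt_integral_of_dominated_of_fderiv_le
      (F := fun y σ => F (φ σ y)) (F' := fun y σ => A σ y) (x₀ := x) (a := 0) (b := s)
      (μ := MeasureTheory.volume) (bound := fun _ => C) (Metric.closedBall_mem_nhds x one_pos)
      (Filter.Eventually.of_forall fun y => (hFφ y).aestronglyMeasurable)
      ((hFφ x).intervalIntegrable _ _) hAx.aestronglyMeasurable
      (Filter.Eventually.of_forall fun σ hσ y hy => hC (σ, y) ⟨uIoc_subset_uIcc hσ, hy⟩)
      intervalIntegrable_const
      (Filter.Eventually.of_forall fun σ _ y _ =>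
        (hF.differentiable one_ne_zero).differentiableAt.hasFDerivAt.comp y
          (hd σ y).differentiableAt.hasFDerivAt)
    have h2 : HasFDerivAt (φ s) (ContinuousLinearMap.id ℝ E + ∫ σ in (0 : ℝ)..s, A σ x) x :=
      ((hasFDerivAt_id x).add h).congr_of_eventuallyEq
        (Filter.Eventually.of_forall fun y => hint s y)
    exact h2.fderiv
  have h3 := (hAx.integral_hasStrictDerivAt 0 t).hasDerivAt.const_add (ContinuousLinearMap.id ℝ E)
  exact h3.congr_of_eventuallyEq (Filter.Eventually.of_forall hAint)

end IsGlobalFlow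

theorem exists_isGlobalFlow {E : Type*} [NormedAddCommGroup E] [NormedSpace ℝ E]
    [CompleteSpace E] {F : E → E} {K M : NNReal} (hK : LipschitzWith K F) (hM : ∀ x, ‖F x‖ ≤ M) :
    ∃ φ : ℝ → E → E, IsGlobalFlow F φ := by
  choose γ hγ0 hγ using exists_global_integralCurve hK hM
  exact ⟨fun t x => γ x t, hγ0, fun t x => hγ x t⟩

/-! ### Multipliers of block triangular maps -/

theorem multipliers_eq_of_charpoly_eq {V X : Type*} [NormedAddCommGroup V] [NormedSpace ℝ V]
    [FiniteDimensional ℝ V] [NormedAddCommGroup X] [NormedSpace ℝ X] [FiniteDimensional ℝ X]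
    {B : V →L[ℝ] V} {A : X →L[ℝ] X}
    (h : (B : V →ₗ[ℝ] V).charpoly =
      (A : X →ₗ[ℝ] X).charpoly * (Polynomial.X - Polynomial.C 1)) :
    nontrivialMultipliers 1 B = multipliers A := by
  classical
  have h0 : (A : X →ₗ[ℝ] X).charpoly * (Polynomial.X - Polynomial.C 1) ≠ 0 :=
    mul_ne_zero (LinearMap.charpoly_monic _).ne_zero (Polynomial.X_sub_C_ne_zero 1)
  rw [nontrivialMultipliers, multipliers, h, Polynomial.aroots_mul h0, Polynomial.aroots_X_sub_C,
    multipliers]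
  simp

/-- In the splitting given by `e`, the map `B` is block lower triangular with diagonal blocks `A`
and `1`. -/
theorem charpoly_lowerTriangular {X V : Type*} [AddCommGroup X] [Module ℝ X]
    [FiniteDimensional ℝ X] [AddCommGroup V] [Module ℝ V] [FiniteDimensional ℝ V]
    (e : (X × ℝ) ≃ₗ[ℝ] V) (B : V →ₗ[ℝ] V) (A : X →ₗ[ℝ] X) (l : X → ℝ)
    (h1 : ∀ ξ, B (e (ξ, 0)) = e (A ξ, l ξ)) (h2 : B (e (0, 1)) = e (0, 1)) :
    B.charpoly = A.charpoly * (Polynomial.X - Polynomial.C 1) := by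
  let b := Module.Free.chooseBasis ℝ X
  let b₁ : Module.Basis Unit ℝ ℝ := Module.Basis.singleton Unit ℝ
  rw [← LinearEquiv.charpoly_conj e.symm, ← LinearMap.charpoly_toMatrix A b,
    ← LinearMap.charpoly_toMatrix (e.symm.conj B) (b.prod b₁)]
  have hB : LinearMap.toMatrix (b.prod b₁) (b.prod b₁) (e.symm.conj B) =
      Matrix.fromBlocks (LinearMap.toMatrix b b A) 0 (Matrix.of fun _ j => l (b j)) 1 := by
    ext (i | i) (j | j) <;> simp [LinearMap.toMatrix_apply, LinearEquiv.conj_apply, h1, h2, b₁]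
  rw [hB, Matrix.charpoly_fromBlocks_zero₁₂]
  congr 1
  simp [Matrix.charpoly_one]

theorem charpoly_upperTriangular {X : Type*} [AddCommGroup X] [Module ℝ X]
    [FiniteDimensional ℝ X] (B : (X × ℝ) →ₗ[ℝ] (X × ℝ)) (A : X →ₗ[ℝ] X)
    (h1 : ∀ ξ, B (ξ, 0) = (A ξ, 0)) (h2 : (B (0, 1)).2 = 1) :
    B.charpoly = A.charpoly * (Polynomial.X - Polynomial.C 1) := by
  let b := Module.Free.chooseBasis ℝ X
  let b₁ : Module.Basis Unit ℝ ℝ := Module.Basis.singleton Unit ℝ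
  rw [← LinearMap.charpoly_toMatrix A b, ← LinearMap.charpoly_toMatrix B (b.prod b₁)]
  have hB : LinearMap.toMatrix (b.prod b₁) (b.prod b₁) B =
      Matrix.fromBlocks (LinearMap.toMatrix b b A)
        (Matrix.of fun i _ => b.repr (B (0, 1)).1 i) 0 1 := by
    ext (i | i) (j | j) <;> simp [LinearMap.toMatrix_apply, h1, h2, b₁]
  rw [hB, Matrix.charpoly_fromBlocks_zero₂₁]
  congr 1
  simp [Matrix.charpoly_one]

theorem mem_multipliers_iff_det_eq_zero {X ι : Type*} [NormedAddCommGroup X] [NormedSpace ℝ X]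
    [FiniteDimensional ℝ X] [Fintype ι] [DecidableEq ι] (b : Module.Basis ι ℝ X) {A : X →L[ℝ] X}
    {μ : ℂ} : μ ∈ multipliers A ↔
      (Matrix.scalar ι μ -
        (LinearMap.toMatrix b b (A : X →ₗ[ℝ] X)).map (algebraMap ℝ ℂ)).det = 0 := by
  rw [multipliers, Polynomial.mem_aroots, ← Matrix.eval_charpoly, Matrix.charpoly_map,
    LinearMap.charpoly_toMatrix, Polynomial.eval_map_algebraMap]
  exact and_iff_right (LinearMap.charpoly_monic _).ne_zero

/-- Hyperbolicity persists: if `A a` depends continuously on `a` and `A a₀` has no eigenvalue on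
the unit circle, then neither has `A a` for `a` near `a₀`. -/
theorem eventually_multipliers_off_circle {P X : Type*} [TopologicalSpace P]
    [NormedAddCommGroup X] [NormedSpace ℝ X] [FiniteDimensional ℝ X] {A : P → X →L[ℝ] X} {a₀ : P}
    (hA : ContinuousAt A a₀) (h : ∀ μ ∈ multipliers (A a₀), ‖μ‖ ≠ 1) :
    ∀ᶠ a in 𝓝 a₀, ∀ μ ∈ multipliers (A a), ‖μ‖ ≠ 1 := by
  let b := Module.Free.chooseBasis ℝ X
  let D : (X →L[ℝ] X) × ℂ → ℂ := fun p => (Matrix.scalar _ p.2 -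
    (LinearMap.toMatrix b b (p.1 : X →ₗ[ℝ] X)).map (algebraMap ℝ ℂ)).det
  have hD : Continuous D := by
    refine Continuous.matrix_det (Continuous.sub ?_ ?_)
    · exact (Continuous.matrix_diagonal (continuous_pi fun _ => continuous_snd))
    · refine Continuous.matrix_map ?_ Complex.continuous_ofReal
      let L : (X →L[ℝ] X) →ₗ[ℝ] Matrix _ _ ℝ :=
        (LinearMap.toMatrix b b).toLinearMap ∘ₗ ContinuousLinearMap.coeLM ℝ
      exact L.continuous_of_finiteDimensional.comp continuous_fst
  have key : ∀ᶠ a in 𝓝 a₀, ∀ μ ∈ Metric.sphere (0 : ℂ) 1, D (A a, μ) ≠ 0 := by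
    refine (isCompact_sphere (0 : ℂ) 1).eventually_forall_of_forall_eventually fun μ hμ => ?_
    have hc : ContinuousAt (fun z : P × ℂ => D (A z.1, z.2)) (a₀, μ) :=
      hD.continuousAt.comp ((ContinuousAt.comp (x := (a₀, μ)) hA continuousAt_fst).prodMk
        continuousAt_snd)
    refine hc.eventually_ne fun h0 => ?_
    exact h μ ((mem_multipliers_iff_det_eq_zero b).2 h0) (by simpa using hμ)
  filter_upwards [key] with a ha μ hμ h1
  exact ha μ (by simpa using h1) ((mem_multipliers_iff_det_eq_zero b).1 hμ)

theorem isInvertible_sub_id_of_multipliers {X : Type*} [NormedAddCommGroup X] [NormedSpace ℝ X]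
    [FiniteDimensional ℝ X] {A : X →L[ℝ] X} (h : ∀ μ ∈ multipliers A, ‖μ‖ ≠ 1) :
    (A - ContinuousLinearMap.id ℝ X).IsInvertible := by
  have hinj : Function.Injective ((A - ContinuousLinearMap.id ℝ X : X →L[ℝ] X) : X →ₗ[ℝ] X) := by
    refine (injective_iff_map_eq_zero _).2 fun v hv => ?_
    by_contra hv0
    have hAv : A v = v := by simpa [sub_eq_zero] using hv
    have h1 : Module.End.HasEigenvalue (A : X →ₗ[ℝ] X) 1 :=
      Module.End.hasEigenvalue_of_hasEigenvector (x := v)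
        ⟨Module.End.mem_eigenspace_iff.2 (by simpa using hAv), hv0⟩
    have h2 := (Module.End.hasEigenvalue_iff_isRoot_charpoly _ _).1 h1
    refine h 1 (Polynomial.mem_aroots.2 ⟨(LinearMap.charpoly_monic _).ne_zero, ?_⟩) (by simp)
    have h3 := Polynomial.aeval_algebraMap_apply ℂ (1 : ℝ) ((A : X →ₗ[ℝ] X).charpoly)
    rw [map_one] at h3
    rw [h3]
    simpa [Polynomial.aeval_def] using h2
  exact ⟨(LinearEquiv.ofInjectiveEndo _ hinj).toContinuousLinearEquiv, by ext v; rfl⟩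

/-! ### Implicit functions and crossing times -/

/-- The implicit function theorem, with smoothness of the implicit function in a whole
neighbourhood. For `r = ∞` this is stronger than smoothness at the base point; it follows because
the implicit functions based at nearby solutions agree, by uniqueness. -/
theorem exists_implicitFunction {E₁ E₂ G : Type*} [NormedAddCommGroup E₁] [NormedSpace ℝ E₁]
    [CompleteSpace E₁] [NormedAddCommGroup E₂] [NormedSpace ℝ E₂] [CompleteSpace E₂]
    [NormedAddCommGroup G] [NormedSpace ℝ G] [CompleteSpace G] {r : ℕ∞} (hr : 1 ≤ r)
    {f : E₁ × E₂ → G} {a : E₁} {b : E₂} (hf : ∀ᶠ v in 𝓝 (a, b), ContDiffAt ℝ r f v)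
    (hab : f (a, b) = 0) (hinv : (fderiv ℝ f (a, b) ∘L .inr ℝ E₁ E₂).IsInvertible) :
    ∃ ψ : E₁ → E₂, ψ a = b ∧ (∀ᶠ x in 𝓝 a, ContDiffAt ℝ r ψ x) ∧
      ∀ᶠ v in 𝓝 (a, b), f v = 0 ↔ v.2 = ψ v.1 := by
  have hr0 : (r : WithTop ℕ∞) ≠ 0 := by
    have : r ≠ 0 := (zero_lt_one.trans_le hr).ne'
    exact_mod_cast this
  have hr1 : (1 : WithTop ℕ∞) ≤ r := by exact_mod_cast hr
  have hfa := hf.self_of_nhds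
  set ψ := hfa.implicitFunction hr0 hinv with hψ
  have hψa : ψ a = b := hfa.implicitFunction_apply_self hr0 hinv
  have hiff := hfa.eventually_apply_eq_iff_implicitFunction hr0 hinv
  rw [hab] at hiff
  have hψ1 : ContDiffAt ℝ 1 ψ a := (hfa.contDiffAt_implicitFunction hr0 hinv).of_le hr1
  have hψc : ContinuousAt (fun x => (x, ψ x)) a := continuousAt_id.prodMk hψ1.continuousAt
  have hψt : Filter.Tendsto (fun x => (x, ψ x)) (𝓝 a) (𝓝 (a, b)) := by
    have := hψc.tendsto
    rwa [hψa] at this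
  have hinv' : ∀ᶠ v in 𝓝 (a, b), (fderiv ℝ f v ∘L .inr ℝ E₁ E₂).IsInvertible := by
    have hc : ContinuousAt (fun v => fderiv ℝ f v ∘L .inr ℝ E₁ E₂) (a, b) :=
      ((hfa.of_le hr1).continuousAt_fderiv one_ne_zero).clm_comp continuousAt_const
    exact hc.eventually_mem (ContinuousLinearEquiv.isOpen.mem_nhds hinv)
  refine ⟨ψ, hψa, ?_, ?_⟩
  · filter_upwards [hψt.eventually hiff.eventually_nhds, hψt.eventually hf,
      hψt.eventually hinv', (hψ1.eventually (by simp)).eventually_nhds] with x h1 h2 h3 h4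
    have hx0 : f (x, ψ x) = 0 := h1.self_of_nhds.2 rfl
    have hxi := h2.eventually_apply_eq_iff_implicitFunction hr0 h3
    have hcx : Filter.Tendsto (fun y => (y, ψ y)) (𝓝 x) (𝓝 (x, ψ x)) :=
      (continuousAt_id.prodMk h4.self_of_nhds.continuousAt).tendsto
    refine (h2.contDiffAt_implicitFunction hr0 h3).congr_of_eventuallyEq ?_
    filter_upwards [hcx.eventually hxi, hcx.eventually h1] with y hy1 hy2
    rw [hx0] at hy1
    exact (hy1.1 (hy2.2 rfl)).symm
  · filter_upwards [hiff] with v hv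
    rw [hv, eq_comm]

theorem ContinuousLinearMap.isInvertible_real {A : ℝ →L[ℝ] ℝ} (h : A 1 ≠ 0) : A.IsInvertible :=
  ⟨ContinuousLinearEquiv.unitsEquivAut ℝ (Units.mk0 (A 1) h), by ext; simp⟩

/-- An orbit that meets the level set `D = 0` transversally at time `T` is followed by nearby orbits,
which meet the level set at exactly one time near `T`, depending smoothly on the initial value. -/
theorem exists_crossingTime {E : Type*} [NormedAddCommGroup E] [NormedSpace ℝ E] [CompleteSpace E]
    {r : ℕ∞} (hr : 1 ≤ r) {F : E → E} {φ : ℝ → E → E} (hφ : IsGlobalFlow F φ)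
    (hφr : ContDiff ℝ r (fun p : ℝ × E => φ p.1 p.2)) {D : E → ℝ} (hD : ContDiff ℝ r D)
    {p : E} {T : ℝ} (h0 : D (φ T p) = 0) (htr : fderiv ℝ D (φ T p) (F (φ T p)) ≠ 0) :
    ∃ τ : E → ℝ, τ p = T ∧ (∀ᶠ q in 𝓝 p, ContDiffAt ℝ r τ q) ∧
      ∃ δ > 0, ∀ᶠ q in 𝓝 p, |τ q - T| < δ ∧ ∀ t, |t - T| < δ → (D (φ t q) = 0 ↔ t = τ q) := by
  have hr1 : (1 : WithTop ℕ∞) ≤ r := by exact_mod_cast hr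
  have hf : ContDiff ℝ r (fun v : E × ℝ => D (φ v.2 v.1)) :=
    hD.comp (hφr.comp (contDiff_snd.prodMk contDiff_fst))
  have hinv : (fderiv ℝ (fun v : E × ℝ => D (φ v.2 v.1)) (p, T) ∘L .inr ℝ E ℝ).IsInvertible := by
    apply ContinuousLinearMap.isInvertible_real
    have h1 : HasFDerivAt (fun t => D (φ t p))
        (fderiv ℝ (fun v : E × ℝ => D (φ v.2 v.1)) (p, T) ∘L .inr ℝ E ℝ) T :=
      ((hf.of_le hr1).differentiable one_ne_zero).differentiableAt.hasFDerivAt.comp T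
        (hasFDerivAt_prodMk_right p T)
    have h2 : HasDerivAt (fun t => D (φ t p)) (fderiv ℝ D (φ T p) (F (φ T p))) T :=
      ((hD.of_le hr1).differentiable one_ne_zero).differentiableAt.hasFDerivAt.comp_hasDerivAt T
        (hφ.hasDerivAt T p)
    rw [h1.hasDerivAt.unique h2]
    exact htr
  obtain ⟨τ, hτp, hτr, hiff⟩ := exists_implicitFunction hr
    (Filter.Eventually.of_forall fun v => hf.contDiffAt) h0 hinv
  refine ⟨τ, hτp, hτr, ?_⟩
  rw [nhds_prod_eq] at hiff
  obtain ⟨P, hP, Q, hQ, hPQ⟩ := Filter.eventually_prod_iff.1 hiff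
  obtain ⟨δ, hδ, hδQ⟩ := Metric.eventually_nhds_iff.1 hQ
  refine ⟨δ, hδ, ?_⟩
  have hc : ∀ᶠ q in 𝓝 p, |τ q - T| < δ := by
    have := hτr.self_of_nhds.continuousAt.eventually_mem (Metric.ball_mem_nhds _ hδ)
    filter_upwards [this] with q hq
    rw [hτp] at hq
    exact hq
  filter_upwards [hc, hP] with q h1 h2
  exact ⟨h1, fun t ht => hPQ h2 (hδQ ht)⟩

/-- The crossing time of `exists_crossingTime` along a closed orbit of minimal period `T` is a first
return time, as far as the part of the section over a small set `O` is concerned. Near the times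
`0` and `T` this is the uniqueness of crossings, and in between it is compactness. -/
theorem exists_firstReturnTime {E H : Type*} [NormedAddCommGroup E] [NormedSpace ℝ E]
    [CompleteSpace E] [TopologicalSpace H] [T2Space H]
    {r : ℕ∞} (hr : 1 ≤ r) {F : E → E} {φ : ℝ → E → E} (hφ : IsGlobalFlow F φ)
    (hφr : ContDiff ℝ r (fun p : ℝ × E => φ p.1 p.2)) {D : E → ℝ} (hD : ContDiff ℝ r D)
    {π : E → H} (hπ : Continuous π) {p : E} {T : ℝ} (hT : 0 < T) (hp : φ T p = p)
    (hmin : ∀ t ∈ Ioo 0 T, π (φ t p) ≠ π p) (h0 : D p = 0) (htr : fderiv ℝ D p (F p) ≠ 0) :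
    ∃ τ : E → ℝ, τ p = T ∧ (∀ᶠ q in 𝓝 p, ContDiffAt ℝ r τ q) ∧ ∃ O ∈ 𝓝 (π p),
      ∀ᶠ q in 𝓝 p, 0 < τ q ∧ τ q < T + 1 ∧ D (φ (τ q) q) = 0 ∧
        (D q = 0 → ∀ t ∈ Ioo 0 (τ q), ¬(D (φ t q) = 0 ∧ π (φ t q) ∈ O)) := by
  obtain ⟨τ, hτp, hτr, δ, hδ, hτ⟩ := exists_crossingTime hr hφ hφr hD (p := p) (T := T)
    (by rwa [hp]) (by rwa [hp])
  obtain ⟨τ', hτ'p, hτ'r, δ', hδ', hτ'⟩ := exists_crossingTime hr hφ hφr hD (p := p) (T := 0)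
    (by rwa [hφ.map_zero]) (by rwa [hφ.map_zero])
  have hsep : ∀ᶠ z : E × H in 𝓝 (p, π p), ∀ t ∈ Icc δ' (T - δ), π (φ t z.1) ≠ z.2 := by
    refine isCompact_Icc.eventually_forall_of_forall_eventually fun t ht => ?_
    have hne : π (φ t p) ≠ π p := hmin t ⟨hδ'.trans_le ht.1, by linarith [ht.2]⟩
    have hc : Continuous fun z : (E × H) × ℝ => (π (φ z.2 z.1.1), z.1.2) :=
      (hπ.comp (hφr.continuous.comp (continuous_snd.prodMk
        (continuous_fst.comp continuous_fst)))).prodMk (continuous_snd.comp continuous_fst)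
    have ho : IsOpen {y : H × H | y.1 ≠ y.2} := isOpen_ne_fun continuous_fst continuous_snd
    exact (hc.continuousAt (x := ((p, π p), t))).eventually_mem (ho.mem_nhds hne)
  rw [nhds_prod_eq] at hsep
  obtain ⟨P, hP, Q, hQ, hPQ⟩ := Filter.eventually_prod_iff.1 hsep
  have hcont : ContinuousAt τ p := hτr.self_of_nhds.continuousAt
  refine ⟨τ, hτp, hτr, {y | Q y}, hQ, ?_⟩
  filter_upwards [hτ, hτ', hP, hcont.eventually (lt_mem_nhds (hτp.symm ▸ hT)),
    hcont.eventually (gt_mem_nhds (by rw [hτp]; exact lt_add_one T))] with q h1 h2 h3 h4 h5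
  refine ⟨h4, h5, (h1.2 _ h1.1).2 rfl, fun hq t ht => ?_⟩
  rintro ⟨hDt, hO⟩
  have hτ'q : 0 = τ' q := (h2.2 0 (by simpa using hδ')).1 (by rwa [hφ.map_zero])
  rcases lt_or_ge t δ' with h | h
  · have := (h2.2 t (by rw [sub_zero, abs_of_pos ht.1]; exact h)).1 hDt
    linarith [ht.1]
  rcases lt_or_ge (T - δ) t with h' | h'
  · have h6 := (abs_lt.1 h1.1).2
    have := (h1.2 t (abs_lt.2 ⟨by linarith, by linarith [ht.2]⟩)).1 hDt
    linarith [ht.2]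
  · exact hPQ h3 hO t ⟨h, h'⟩ rfl

/-! ### The expansion in the small parameter -/

/-- Hadamard's lemma in one variable: `H (z, ε) = H (z, 0) + ε G (z, ε)`, where
`G (z, ε) = ∫ D_ε H (z, s ε) ds` loses one derivative. -/
theorem exists_expansion {V G : Type u} [NormedAddCommGroup V] [NormedSpace ℝ V]
    [NormedAddCommGroup G] [NormedSpace ℝ G] [CompleteSpace G] {r : ℕ∞} (hr : 1 ≤ r)
    {H : V × ℝ → G} (hH : ContDiff ℝ r H) :
    ∃ R : V × ℝ → G, ContDiff ℝ (r - 1 : ℕ∞) R ∧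
      ∀ z ε, H (z, ε) = H (z, 0) + ε • R (z, ε) := by
  have hr1 : (1 : WithTop ℕ∞) ≤ r := by exact_mod_cast hr
  have hle : ((r - 1 : ℕ∞) : WithTop ℕ∞) + 1 ≤ r := by
    have : r - 1 + 1 ≤ r := (tsub_add_cancel_of_le hr).le
    exact_mod_cast this
  let k : (V × ℝ) × ℝ → G := fun p => fderiv ℝ H (p.1.1, p.2 * p.1.2) (0, 1)
  have hk : ContDiff ℝ (r - 1 : ℕ∞) k := by
    have h1 : ContDiff ℝ (r - 1 : ℕ∞) fun p : (V × ℝ) × ℝ => (p.1.1, p.2 * p.1.2) :=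
      contDiff_fst.fst.prodMk (contDiff_snd.mul contDiff_fst.snd)
    exact ((hH.fderiv_right hle).comp h1).clm_apply contDiff_const
  refine ⟨fun p => ∫ s in (0 : ℝ)..1, k (p, s), contDiff_integral_param hk, fun z ε => ?_⟩
  have hd : ∀ s : ℝ, HasDerivAt (fun s : ℝ => H (z, s * ε)) (ε • k ((z, ε), s)) s := by
    intro s
    have h1 : HasDerivAt (fun s : ℝ => (z, s * ε)) ((0 : V), 1 * ε) s :=
      (hasDerivAt_const s z).prodMk ((hasDerivAt_id s).mul_const ε)
    have h2 := ((hH.of_le hr1).differentiable one_ne_zero).differentiableAt.hasFDerivAt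
      (x := (z, s * ε)) |>.comp_hasDerivAt s h1
    have h3 : ((0 : V), 1 * ε) = ε • ((0 : V), (1 : ℝ)) := by simp
    rw [h3, map_smul] at h2
    exact h2
  have hc : Continuous fun s => ε • k ((z, ε), s) :=
    (hk.continuous.comp (by fun_prop : Continuous fun s : ℝ => ((z, ε), s))).const_smul ε
  have h := intervalIntegral.integral_eq_sub_of_hasDerivAt (a := 0) (b := 1) (fun s _ => hd s)
    (hc.intervalIntegrable _ _)
  rw [intervalIntegral.integral_smul] at h
  rw [h]
  simp

/-- A map that is `C^r` near a point agrees near that point with a map that is `C^r` everywhere. -/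
theorem exists_contDiff_eventuallyEq {V G : Type*} [NormedAddCommGroup V] [NormedSpace ℝ V]
    [FiniteDimensional ℝ V] [NormedAddCommGroup G] [NormedSpace ℝ G] {r : ℕ∞} {H : V → G} {a : V}
    (hH : ∀ᶠ z in 𝓝 a, ContDiffAt ℝ r H z) : ∃ H' : V → G, ContDiff ℝ r H' ∧ H' =ᶠ[𝓝 a] H := by
  obtain ⟨ρ, hρ, hball⟩ := Metric.eventually_nhds_iff_ball.1 hH
  let b : ContDiffBump a := ⟨ρ / 3, ρ / 2, by positivity, by linarith⟩
  refine ⟨fun z => b z • H z, contDiff_iff_contDiffAt.2 fun z => ?_, ?_⟩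
  · by_cases hz : z ∈ Metric.ball a ρ
    · exact b.contDiffAt.smul (hball z hz)
    · have hz' : ρ / 2 < dist z a := by
        have := not_lt.1 (mt Metric.mem_ball.2 hz)
        linarith
      refine contDiffAt_const (c := (0 : G)) |>.congr_of_eventuallyEq ?_
      filter_upwards [(continuous_id.dist (continuous_const (y := a))).continuousAt.eventually
        (lt_mem_nhds hz')] with y hy
      rw [b.zero_of_le_dist (x := y) (le_of_lt hy), zero_smul]
  · filter_upwards [b.eventuallyEq_one] with z hz
    simp [hz]

/-! ### The truncated extended system -/

/-- The extended system `z' = f`, `α' = ε g`, `ε' = 0` agrees near any bounded piece of `ε = 0` with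
a smooth complete vector field that respects the invariance of `ε`, and of `α` for `ε = 0`. -/
theorem exists_truncation {Z : Type*} [NormedAddCommGroup Z] [NormedSpace ℝ Z]
    [FiniteDimensional ℝ Z] {r : ℕ∞} (hr : 1 ≤ r) {ε₀ : ℝ} (hε₀ : 0 < ε₀)
    {f : Z × ℝ × ℝ → Z} {g : Z × ℝ × ℝ → ℝ}
    (hf : ContDiffOn ℝ r f (univ ×ˢ univ ×ˢ Ioo (-ε₀) ε₀))
    (hg : ContDiffOn ℝ r g (univ ×ˢ univ ×ˢ Ioo (-ε₀) ε₀)) {R : ℝ} (hR : 0 < R) :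
    ∃ (F : Z × ℝ × ℝ → Z × ℝ × ℝ) (K : NNReal) (φ : ℝ → Z × ℝ × ℝ → Z × ℝ × ℝ)
      (N : Set (Z × ℝ × ℝ)),
      ContDiff ℝ r F ∧ LipschitzWith K F ∧ IsGlobalFlow F φ ∧ (∀ p, (F p).2.2 = 0) ∧
      (∀ p, p.2.2 = 0 → (F p).2.1 = 0) ∧ IsOpen N ∧
      (∀ z α, ‖z‖ < R → |α| < R → (z, α, (0 : ℝ)) ∈ N) ∧
      ∀ p ∈ N, F p = (f p, p.2.2 * g p, 0) := by
  have hr0 : (r : WithTop ℕ∞) ≠ 0 := by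
    have : r ≠ 0 := (zero_lt_one.trans_le hr).ne'
    exact_mod_cast this
  let b₁ : ContDiffBump (0 : Z × ℝ) := ⟨R, R + 1, hR, by linarith⟩
  let b₂ : ContDiffBump (0 : ℝ) := ⟨ε₀ / 4, ε₀ / 2, by positivity, by linarith⟩
  let F : Z × ℝ × ℝ → Z × ℝ × ℝ := fun p =>
    (b₁ (p.1, p.2.1) * b₂ p.2.2) • (f p, p.2.2 * g p, (0 : ℝ))
  have hF0 : ∀ p : Z × ℝ × ℝ, ε₀ / 2 ≤ |p.2.2| → F p = 0 := by
    intro p hp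
    have : b₂ p.2.2 = 0 := b₂.zero_of_le_dist (by simpa [b₂] using hp)
    simp [F, this]
  have hF : ContDiff ℝ r F := by
    refine contDiff_iff_contDiffAt.2 fun p => ?_
    by_cases hp : |p.2.2| < ε₀
    · have hmem : (univ ×ˢ univ ×ˢ Ioo (-ε₀) ε₀ : Set (Z × ℝ × ℝ)) ∈ 𝓝 p :=
        (isOpen_univ.prod (isOpen_univ.prod isOpen_Ioo)).mem_nhds
          ⟨mem_univ _, mem_univ _, abs_lt.1 hp⟩
      have h1 : ContDiffAt ℝ r (fun p : Z × ℝ × ℝ => b₁ (p.1, p.2.1)) p :=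
        (b₁.contDiff.comp (contDiff_fst.prodMk contDiff_snd.fst)).contDiffAt
      have h2 : ContDiffAt ℝ r (fun p : Z × ℝ × ℝ => b₂ p.2.2) p :=
        (b₂.contDiff.comp contDiff_snd.snd).contDiffAt
      have h3 : ContDiffAt ℝ r (fun p : Z × ℝ × ℝ => p.2.2) p := contDiff_snd.snd.contDiffAt
      exact (h1.mul h2).smul ((hf.contDiffAt hmem).prodMk
        ((h3.mul (hg.contDiffAt hmem)).prodMk contDiffAt_const))
    · refine contDiffAt_const (c := (0 : Z × ℝ × ℝ)) |>.congr_of_eventuallyEq ?_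
      have hc : Continuous fun p : Z × ℝ × ℝ => |p.2.2| := by fun_prop
      filter_upwards [hc.continuousAt.eventually
        (lt_mem_nhds (show ε₀ / 2 < |p.2.2| by linarith [not_lt.1 hp]))] with q hq
      exact hF0 q hq.le
  have hsupp : HasCompactSupport F := by
    refine HasCompactSupport.intro (isCompact_closedBall (0 : Z × ℝ × ℝ) (R + 1 + ε₀))
      fun p hp => ?_
    by_cases h1 : ε₀ / 2 ≤ |p.2.2|
    · exact hF0 p h1
    · have h2 : R + 1 ≤ ‖((p.1, p.2.1) : Z × ℝ)‖ := by
        by_contra h2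
        apply hp
        rw [mem_closedBall_zero_iff]
        rw [Prod.norm_def, not_le, max_lt_iff] at h2
        simp only [Prod.norm_def, max_le_iff, Real.norm_eq_abs] at h2 ⊢
        exact ⟨by linarith, by linarith, by linarith⟩
      have : b₁ (p.1, p.2.1) = 0 := b₁.zero_of_le_dist (by simpa [b₁] using h2)
      simp [F, this]
  obtain ⟨K, hK⟩ := hF.lipschitzWith_of_hasCompactSupport hsupp hr0
  obtain ⟨M, hM⟩ := hsupp.exists_bound_of_continuous hF.continuous
  obtain ⟨φ, hφ⟩ := exists_isGlobalFlow hK (M := M.toNNReal)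
    (fun x => (hM x).trans (Real.le_coe_toNNReal M))
  refine ⟨F, K, φ, {p | ‖p.1‖ < R ∧ |p.2.1| < R ∧ |p.2.2| < ε₀ / 4}, hF, hK, hφ, ?_, ?_, ?_, ?_, ?_⟩
  · intro p; simp [F]
  · intro p hp; simp [F, hp]
  · have h1 : Continuous fun p : Z × ℝ × ℝ => ‖p.1‖ := by fun_prop
    have h2 : Continuous fun p : Z × ℝ × ℝ => |p.2.1| := by fun_prop
    have h3 : Continuous fun p : Z × ℝ × ℝ => |p.2.2| := by fun_prop
    exact (isOpen_lt h1 continuous_const).inter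
      ((isOpen_lt h2 continuous_const).inter (isOpen_lt h3 continuous_const))
  · intro z α hz hα
    exact ⟨hz, hα, by simpa using hε₀⟩
  · rintro p ⟨h1, h2, h3⟩
    have h4 : b₁ (p.1, p.2.1) = 1 := b₁.one_of_mem_closedBall (by
      simp only [mem_closedBall_zero_iff, Prod.norm_def, max_le_iff]
      exact ⟨h1.le, h2.le⟩)
    have h5 : b₂ p.2.2 = 1 := b₂.one_of_mem_closedBall (by
      simpa [b₂] using h3.le)
    simp [F, h4, h5]

namespace IsGlobalFlow

/-- Functionals annihilated by the vector field along an orbit are conserved along it. -/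
theorem conserved {E G : Type*} [NormedAddCommGroup E] [NormedSpace ℝ E] [NormedAddCommGroup G]
    [NormedSpace ℝ G] {F : E → E} {φ : ℝ → E → E} (hφ : IsGlobalFlow F φ) (L : E →L[ℝ] G) {x : E}
    (h : ∀ t, L (F (φ t x)) = 0) (t : ℝ) : L (φ t x) = L x := by
  have hd : ∀ t, HasDerivAt (fun t => L (φ t x)) 0 t := fun t => by
    have := L.hasFDerivAt.comp_hasDerivAt t (hφ.hasDerivAt t x)
    rwa [h t] at this
  have := is_const_of_deriv_eq_zero (fun t => (hd t).differentiableAt) (fun t => (hd t).deriv) t 0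
  simpa [hφ.map_zero] using this

variable {Z : Type*} [NormedAddCommGroup Z] [NormedSpace ℝ Z] {F : Z × ℝ × ℝ → Z × ℝ × ℝ}
  {φ : ℝ → Z × ℝ × ℝ → Z × ℝ × ℝ}

theorem epsilon_const (hφ : IsGlobalFlow F φ) (hF : ∀ p, (F p).2.2 = 0) (t : ℝ) (p : Z × ℝ × ℝ) :
    (φ t p).2.2 = p.2.2 :=
  hφ.conserved ((ContinuousLinearMap.snd ℝ ℝ ℝ).comp (ContinuousLinearMap.snd ℝ Z (ℝ × ℝ)))
    (fun _ => hF _) t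

theorem alpha_const (hφ : IsGlobalFlow F φ) (hF : ∀ p, (F p).2.2 = 0)
    (hF' : ∀ p, p.2.2 = 0 → (F p).2.1 = 0) (t : ℝ) {p : Z × ℝ × ℝ} (hp : p.2.2 = 0) :
    (φ t p).2.1 = p.2.1 :=
  hφ.conserved ((ContinuousLinearMap.fst ℝ ℝ ℝ).comp (ContinuousLinearMap.snd ℝ Z (ℝ × ℝ)))
    (fun t => hF' _ (by rw [hφ.epsilon_const hF, hp])) t

theorem apply_layer (hφ : IsGlobalFlow F φ) (hF : ∀ p, (F p).2.2 = 0)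
    (hF' : ∀ p, p.2.2 = 0 → (F p).2.1 = 0) (t : ℝ) (z : Z) (α : ℝ) :
    φ t (z, α, 0) = ((φ t (z, α, 0)).1, α, 0) :=
  Prod.ext rfl (Prod.ext (hφ.alpha_const hF hF' t rfl) (hφ.epsilon_const hF t _))

/-- The flow of the layer problem with parameter `α`. -/
theorem layer (hφ : IsGlobalFlow F φ) (hF : ∀ p, (F p).2.2 = 0)
    (hF' : ∀ p, p.2.2 = 0 → (F p).2.1 = 0) (α : ℝ) :
    IsGlobalFlow (fun z => (F (z, α, 0)).1) (fun t z => (φ t (z, α, 0)).1) where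
  map_zero z := by rw [hφ.map_zero]
  hasDerivAt t z := by
    have := (hφ.hasDerivAt t (z, α, 0)).fst
    rw [hφ.apply_layer hF hF'] at this
    exact this

end IsGlobalFlow

/-! ### Floquet multipliers and the return map -/

/-- The monodromy operator of a closed orbit through `(x₀, Y x₀)` has the eigenvalues of the
linearised return map `Px` on the section `y = Y x`, and one more eigenvalue `1`. Differentiating
the defining identity of `Px` makes the monodromy block triangular for the splitting of the space
into the tangent space of the section and the flow direction. -/
theorem charpoly_monodromy {X : Type*} [NormedAddCommGroup X] [NormedSpace ℝ X]
    [FiniteDimensional ℝ X] {F : X × ℝ → X × ℝ} {φ : ℝ → X × ℝ → X × ℝ} {K : NNReal}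
    (hφ : IsGlobalFlow F φ) (hK : LipschitzWith K F)
    (hφ1 : ContDiff ℝ 1 (fun p : ℝ × (X × ℝ) => φ p.1 p.2)) {Y τ : X → ℝ} {Px : X → X} {x₀ : X}
    (hY : DifferentiableAt ℝ Y x₀) (hτ : DifferentiableAt ℝ τ x₀) (hP : DifferentiableAt ℝ Px x₀)
    (hfix : Px x₀ = x₀) (hret : ∀ᶠ x in 𝓝 x₀, φ (τ x) (x, Y x) = (Px x, Y (Px x)))
    (htr : (F (x₀, Y x₀)).2 ≠ fderiv ℝ Y x₀ (F (x₀, Y x₀)).1) :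
    ((fderiv ℝ (φ (τ x₀)) (x₀, Y x₀) : X × ℝ →L[ℝ] X × ℝ) : X × ℝ →ₗ[ℝ] X × ℝ).charpoly =
      ((fderiv ℝ Px x₀ : X →L[ℝ] X) : X →ₗ[ℝ] X).charpoly * (Polynomial.X - Polynomial.C 1) := by
  set z₀ : X × ℝ := (x₀, Y x₀) with hz₀
  set T := τ x₀ with hT
  set M := fderiv ℝ (φ T) z₀ with hM
  set A := fderiv ℝ Px x₀ with hA
  set l := fderiv ℝ Y x₀ with hl
  set v := F z₀ with hv
  have hper : φ T z₀ = z₀ := by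
    have := hret.self_of_nhds
    rwa [hfix] at this
  have hMd : HasFDerivAt (φ T) M z₀ := by
    have : DifferentiableAt ℝ (φ T) z₀ :=
      ((hφ1.differentiable one_ne_zero).differentiableAt (x := (T, z₀))).comp z₀
        (f := fun z => (T, z)) (by fun_prop)
    exact this.hasFDerivAt
  have hMv : M v = v := by
    have h1 : HasDerivAt (fun s => φ s z₀) v 0 := by
      have := hφ.hasDerivAt 0 z₀
      rwa [hφ.map_zero] at this
    have h2 : HasDerivAt (fun s => φ T (φ s z₀)) (M v) 0 :=
      HasFDerivAt.comp_hasDerivAt (f := fun s => φ s z₀) 0 (by rwa [hφ.map_zero]) h1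
    have h3 : (fun s => φ T (φ s z₀)) = fun s => φ s z₀ := by
      funext s
      rw [← hφ.map_add hK, add_comm, hφ.map_add hK, hper]
    rw [h3] at h2
    exact h2.unique h1
  have hMσ : ∀ ξ, M (ξ, l ξ) + fderiv ℝ τ x₀ ξ • v = (A ξ, l (A ξ)) := by
    have hs : HasFDerivAt (fun x => (τ x, (x, Y x)))
        ((fderiv ℝ τ x₀).prod ((ContinuousLinearMap.id ℝ X).prod l)) x₀ :=
      hτ.hasFDerivAt.prodMk ((hasFDerivAt_id x₀).prodMk hY.hasFDerivAt)
    have hΦ := ((hφ1.differentiable one_ne_zero).differentiableAt (x := (T, z₀))).hasFDerivAt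
    set DΦ := fderiv ℝ (fun p : ℝ × (X × ℝ) => φ p.1 p.2) (T, z₀)
    have h1 : HasFDerivAt (fun x => φ (τ x) (x, Y x)) (DΦ.comp
        ((fderiv ℝ τ x₀).prod ((ContinuousLinearMap.id ℝ X).prod l))) x₀ :=
      HasFDerivAt.comp x₀ (f := fun x => (τ x, (x, Y x))) hΦ hs
    have h2 : HasFDerivAt (fun x => (Px x, Y (Px x))) (A.prod (l.comp A)) x₀ := by
      refine hP.hasFDerivAt.prodMk (HasFDerivAt.comp x₀ ?_ hP.hasFDerivAt)
      rw [hfix]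
      exact hY.hasFDerivAt
    have h3 := (h1.congr_of_eventuallyEq (hret.mono fun _ h => h.symm)).unique h2
    have h4 : DΦ.comp (.inr ℝ ℝ (X × ℝ)) = M :=
      (hΦ.comp z₀ (hasFDerivAt_prodMk_right T z₀)).unique hMd
    have h5 : DΦ (1, 0) = v := by
      have h6 : HasFDerivAt (fun t => φ t z₀) (DΦ.comp (.inl ℝ ℝ (X × ℝ))) T :=
        HasFDerivAt.comp T (f := fun t => (t, z₀)) hΦ (hasFDerivAt_prodMk_left T z₀)
      have h7 := hφ.hasDerivAt T z₀
      rw [hper] at h7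
      simpa using h6.hasDerivAt.unique h7
    intro ξ
    have h8 := congrArg (fun B => B ξ) h3
    simp only [ContinuousLinearMap.comp_apply, ContinuousLinearMap.prod_apply,
      ContinuousLinearMap.id_apply] at h8
    rw [← h8, ← h4, ← h5, ← map_smul, ContinuousLinearMap.comp_apply, ← map_add]
    simp
  let e₀ : X × ℝ →ₗ[ℝ] X × ℝ :=
    (LinearMap.id.prod (l : X →ₗ[ℝ] ℝ)).coprod (LinearMap.toSpanSingleton ℝ (X × ℝ) v)
  have he₀ : ∀ ξ s, e₀ (ξ, s) = (ξ, l ξ) + s • v := fun ξ s => by simp [e₀]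
  have hinj : Function.Injective e₀ := by
    refine (injective_iff_map_eq_zero _).2 ?_
    rintro ⟨ξ, s⟩ h
    rw [he₀, Prod.ext_iff] at h
    obtain ⟨h1, h2⟩ := h
    simp only [Prod.fst_add, Prod.snd_add, Prod.smul_fst, Prod.smul_snd, Prod.fst_zero,
      Prod.snd_zero, smul_eq_mul] at h1 h2
    have hξ : ξ = -(s • v.1) := eq_neg_of_add_eq_zero_left h1
    have hs : s = 0 := by
      rw [hξ, map_neg, map_smul, smul_eq_mul] at h2
      have h3 : s * (v.2 - l v.1) = 0 := by linarith
      exact (mul_eq_zero.1 h3).resolve_right (sub_ne_zero.2 htr)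
    rw [Prod.mk_eq_zero]
    exact ⟨by simp [hξ, hs], hs⟩
  refine charpoly_lowerTriangular (LinearEquiv.ofInjectiveEndo e₀ hinj) _ _
    (fun ξ => -fderiv ℝ τ x₀ ξ) (fun ξ => ?_) ?_
  · change M (e₀ (ξ, 0)) = e₀ (A ξ, _)
    rw [he₀, he₀, zero_smul, add_zero, ← hMσ ξ, neg_smul]
    abel
  · change M (e₀ (0, 1)) = e₀ (0, 1)
    rw [he₀, map_zero, one_smul, Prod.mk_zero_zero, zero_add, hMv]

/-! ### The return map of the extended system -/

section Coordinates

variable {X : Type*}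

/-- The point of the extended phase space with section coordinates `p.1` and parameter `p.2`. -/
def extendedSectionPoint (Y : X × ℝ → ℝ) (p : (X × ℝ) × ℝ) : (X × ℝ) × ℝ × ℝ :=
  ((p.1.1, Y p.1), p.1.2, p.2)

/-- The function `y - Y (x, α)`, which defines the section in the extended phase space. -/
def sectionDefect (Y : X × ℝ → ℝ) (p : (X × ℝ) × ℝ × ℝ) : ℝ :=
  p.1.2 - Y (p.1.1, p.2.1)

theorem sectionDefect_extendedSectionPoint (Y : X × ℝ → ℝ) (p : (X × ℝ) × ℝ) :
    sectionDefect Y (extendedSectionPoint Y p) = 0 :=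
  sub_self _

theorem eq_extendedSectionPoint {Y : X × ℝ → ℝ} {p : (X × ℝ) × ℝ × ℝ} (h : sectionDefect Y p = 0) :
    p = extendedSectionPoint Y ((p.1.1, p.2.1), p.2.2) :=
  Prod.ext (Prod.ext rfl (sub_eq_zero.1 h)) rfl

end Coordinates

section ReturnMap

variable {X : Type*} [NormedAddCommGroup X] [NormedSpace ℝ X]

theorem contDiff_extendedSectionPoint {r : ℕ∞} {Y : X × ℝ → ℝ} (hY : ContDiff ℝ r Y) :
    ContDiff ℝ r (extendedSectionPoint Y) :=
  (contDiff_fst.fst.prodMk (hY.comp contDiff_fst)).prodMk (contDiff_fst.snd.prodMk contDiff_snd)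

theorem contDiff_sectionDefect {r : ℕ∞} {Y : X × ℝ → ℝ} (hY : ContDiff ℝ r Y) :
    ContDiff ℝ r (sectionDefect Y) :=
  contDiff_fst.snd.sub (hY.comp (contDiff_fst.fst.prodMk contDiff_snd.fst))

theorem fderiv_sectionDefect {Y : X × ℝ → ℝ} (hY : ContDiff ℝ 1 Y) (p v : (X × ℝ) × ℝ × ℝ) :
    fderiv ℝ (sectionDefect Y) p v = v.1.2 - fderiv ℝ Y (p.1.1, p.2.1) (v.1.1, v.2.1) := by
  let L₁ : (X × ℝ) × ℝ × ℝ →L[ℝ] ℝ := (ContinuousLinearMap.snd ℝ X ℝ).comp (.fst ℝ _ _)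
  let L₂ : (X × ℝ) × ℝ × ℝ →L[ℝ] X × ℝ := ((ContinuousLinearMap.fst ℝ X ℝ).comp (.fst ℝ _ _)).prod
    ((ContinuousLinearMap.fst ℝ ℝ ℝ).comp (.snd ℝ _ _))
  have h : HasFDerivAt (sectionDefect Y) (L₁ - (fderiv ℝ Y (p.1.1, p.2.1)).comp L₂) p :=
    L₁.hasFDerivAt.sub (HasFDerivAt.comp p (f := L₂)
      (hY.differentiable one_ne_zero).differentiableAt.hasFDerivAt L₂.hasFDerivAt)
  rw [h.fderiv]
  rfl

/-- The orbit of the section point with coordinates and parameter `p` returns for the first time to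
the section over `W` at the time `τ p.1 p.2` and with coordinates `P p.1 p.2`, all the time staying
in `N`; moreover, `P` and `τ` are `C^r` at `p`. -/
structure ReturnsAt (r : ℕ∞) (φ : ℝ → (X × ℝ) × ℝ × ℝ → (X × ℝ) × ℝ × ℝ) (Y : X × ℝ → ℝ)
    (N : Set ((X × ℝ) × ℝ × ℝ)) (W : Set (X × ℝ)) (P : X × ℝ → ℝ → X × ℝ) (τ : X × ℝ → ℝ → ℝ)
    (p : (X × ℝ) × ℝ) : Prop where
  contDiffAt_map : ContDiffAt ℝ r (fun p : (X × ℝ) × ℝ => P p.1 p.2) p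
  contDiffAt_time : ContDiffAt ℝ r (fun p : (X × ℝ) × ℝ => τ p.1 p.2) p
  time_pos : 0 < τ p.1 p.2
  mem : P p.1 p.2 ∈ W
  eq : φ (τ p.1 p.2) (extendedSectionPoint Y p) = extendedSectionPoint Y (P p.1 p.2, p.2)
  first : ∀ t ∈ Ioo 0 (τ p.1 p.2), ∀ q ∈ W,
    (φ t (extendedSectionPoint Y p)).1 = (q.1, Y q) → (φ t (extendedSectionPoint Y p)).2.1 ≠ q.2
  stays : ∀ t ∈ Icc 0 (τ p.1 p.2), φ t (extendedSectionPoint Y p) ∈ N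

theorem exists_returnMap [FiniteDimensional ℝ X] {r : ℕ∞} (hr : 1 ≤ r)
    {F : (X × ℝ) × ℝ × ℝ → (X × ℝ) × ℝ × ℝ} {φ : ℝ → (X × ℝ) × ℝ × ℝ → (X × ℝ) × ℝ × ℝ}
    (hφ : IsGlobalFlow F φ) (hφr : ContDiff ℝ r (fun p : ℝ × ((X × ℝ) × ℝ × ℝ) => φ p.1 p.2))
    (hF2 : ∀ p, (F p).2.2 = 0) (hF1 : ∀ p, p.2.2 = 0 → (F p).2.1 = 0)
    {Y : X × ℝ → ℝ} (hY : ContDiff ℝ r Y) {N : Set ((X × ℝ) × ℝ × ℝ)} (hN : IsOpen N)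
    {q₀ : X × ℝ} {T : ℝ} (hT : 0 < T)
    (hper : φ T (extendedSectionPoint Y (q₀, 0)) = extendedSectionPoint Y (q₀, 0))
    (hmin : ∀ t ∈ Ioo 0 T, (φ t (extendedSectionPoint Y (q₀, 0))).1 ≠ (q₀.1, Y q₀))
    (htr : (F (extendedSectionPoint Y (q₀, 0))).1.2 ≠
      fderiv ℝ Y q₀ ((F (extendedSectionPoint Y (q₀, 0))).1.1, 0))
    (hstay : ∀ t, φ t (extendedSectionPoint Y (q₀, 0)) ∈ N) {O : Set (X × ℝ)} (hO : O ∈ 𝓝 q₀) :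
    ∃ (W : Set (X × ℝ)) (P : X × ℝ → ℝ → X × ℝ) (τ : X × ℝ → ℝ → ℝ),
      IsOpen W ∧ W ⊆ O ∧ q₀ ∈ W ∧ τ q₀ 0 = T ∧ P q₀ 0 = q₀ ∧
      ∀ᶠ p in 𝓝 (q₀, (0 : ℝ)), ReturnsAt r φ Y N W P τ p := by
  have hr1 : (1 : WithTop ℕ∞) ≤ r := by exact_mod_cast hr
  set p₀ := extendedSectionPoint Y (q₀, 0) with hp₀
  have hS := contDiff_extendedSectionPoint hY
  have hSt : Filter.Tendsto (extendedSectionPoint Y) (𝓝 (q₀, 0)) (𝓝 p₀) :=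
    hS.continuous.tendsto _
  obtain ⟨τ, hτp, hτr, B, hB, hfirst⟩ := exists_firstReturnTime hr hφ hφr
    (contDiff_sectionDefect hY) (π := Prod.fst) continuous_fst hT hper hmin
    (sectionDefect_extendedSectionPoint Y _) (by
      rw [fderiv_sectionDefect (hY.of_le hr1), hF1 _ rfl]
      exact sub_ne_zero.2 htr)
  -- the part of the section over `W` lies over `B` and in the prescribed neighbourhood
  let W : Set (X × ℝ) := interior O ∩ (fun q : X × ℝ => (q.1, Y q)) ⁻¹' interior B
  have hW : IsOpen W := isOpen_interior.inter
    (isOpen_interior.preimage (continuous_fst.prodMk hY.continuous))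
  have hqW : q₀ ∈ W := ⟨mem_interior_iff_mem_nhds.2 hO, mem_interior_iff_mem_nhds.2 hB⟩
  let H : (X × ℝ) × ℝ → X × ℝ := fun p =>
    ((φ (τ (extendedSectionPoint Y p)) (extendedSectionPoint Y p)).1.1,
      (φ (τ (extendedSectionPoint Y p)) (extendedSectionPoint Y p)).2.1)
  have hH₀ : H (q₀, 0) = q₀ := by
    change ((φ (τ p₀) p₀).1.1, (φ (τ p₀) p₀).2.1) = q₀
    rw [hτp, hper]
    rfl
  have hτS : ∀ᶠ p in 𝓝 (q₀, (0 : ℝ)), ContDiffAt ℝ r (fun p => τ (extendedSectionPoint Y p)) p := by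
    filter_upwards [hSt.eventually hτr] with p hp
    exact hp.comp p hS.contDiffAt
  have hHr : ∀ᶠ p in 𝓝 (q₀, (0 : ℝ)), ContDiffAt ℝ r H p := by
    filter_upwards [hτS] with p hp
    have h1 : ContDiffAt ℝ r
        (fun p => φ (τ (extendedSectionPoint Y p)) (extendedSectionPoint Y p)) p :=
      hφr.contDiffAt.comp p (hp.prodMk hS.contDiffAt)
    exact h1.fst.fst.prodMk h1.snd.fst
  have hstay' : ∀ᶠ p in 𝓝 p₀, ∀ t ∈ Icc 0 (T + 1), φ t p ∈ N := by
    refine isCompact_Icc.eventually_forall_of_forall_eventually fun t _ => ?_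
    exact ((hφr.continuous.comp continuous_swap).continuousAt (x := (p₀, t))).eventually_mem
      (hN.mem_nhds (hstay t))
  refine ⟨W, fun q ε => H (q, ε), fun q ε => τ (extendedSectionPoint Y (q, ε)), hW,
    inter_subset_left.trans interior_subset, hqW, hτp, hH₀, ?_⟩
  have hHc : ∀ᶠ p in 𝓝 (q₀, (0 : ℝ)), H p ∈ W :=
    hHr.self_of_nhds.continuousAt.eventually_mem (hW.mem_nhds (by rwa [hH₀]))
  filter_upwards [hHr, hτS, hHc, hSt.eventually hfirst, hSt.eventually hstay'] with p h1 h2 h3 h4 h5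
  obtain ⟨h6, h7, h8, h9⟩ := h4
  refine ⟨h1, h2, h6, h3, ?_, ?_, fun t ht => h5 t ⟨ht.1, ht.2.trans h7.le⟩⟩
  · have h := eq_extendedSectionPoint h8
    rw [hφ.epsilon_const hF2] at h
    exact h
  · intro t ht q hq ha hb
    refine h9 (sectionDefect_extendedSectionPoint Y p) t ht ⟨?_, ?_⟩
    · rw [sectionDefect, ha, hb]
      exact sub_self _
    · rw [ha]
      exact interior_subset hq.2

end ReturnMap

/-! ### Closed orbits of the layer problem -/

theorem lipschitzWith_layer {Z : Type*} [NormedAddCommGroup Z] [NormedSpace ℝ Z]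
    {F : Z × ℝ × ℝ → Z × ℝ × ℝ} {K : NNReal} (hK : LipschitzWith K F) (α : ℝ) :
    LipschitzWith K fun z => (F (z, α, 0)).1 := by
  refine LipschitzWith.of_dist_le_mul fun z w => ?_
  have h1 : dist (F (z, α, 0)).1 (F (w, α, 0)).1 ≤ dist (F (z, α, 0)) (F (w, α, 0)) :=
    le_max_left _ _
  refine h1.trans ((hK.dist_le_mul _ _).trans (le_of_eq ?_))
  simp [Prod.dist_eq]

theorem contDiff_layer {Z : Type*} [NormedAddCommGroup Z] [NormedSpace ℝ Z] {n : WithTop ℕ∞}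
    {F : Z × ℝ × ℝ → Z × ℝ × ℝ} (hF : ContDiff ℝ n F) (α : ℝ) :
    ContDiff ℝ n fun z => (F (z, α, 0)).1 :=
  (hF.comp (contDiff_id.prodMk contDiff_const)).fst

theorem contDiff_layer_flow {Z : Type*} [NormedAddCommGroup Z] [NormedSpace ℝ Z] {n : WithTop ℕ∞}
    {φ : ℝ → Z × ℝ × ℝ → Z × ℝ × ℝ} (hφ : ContDiff ℝ n fun p : ℝ × (Z × ℝ × ℝ) => φ p.1 p.2)
    (α : ℝ) : ContDiff ℝ n fun p : ℝ × Z => (φ p.1 (p.2, α, 0)).1 :=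
  (hφ.comp (contDiff_fst.prodMk (contDiff_snd.prodMk contDiff_const))).fst

theorem fderiv_layer_eq {Z : Type*} [NormedAddCommGroup Z] [NormedSpace ℝ Z]
    {F : Z × ℝ × ℝ → Z × ℝ × ℝ} {f : Z × ℝ × ℝ → Z} {N : Set (Z × ℝ × ℝ)} (hN : IsOpen N)
    (hFN : ∀ p ∈ N, (F p).1 = f p) {z : Z} {α : ℝ} (hz : (z, α, 0) ∈ N) :
    fderiv ℝ (fun z => f (z, α, 0)) z = fderiv ℝ (fun z => (F (z, α, 0)).1) z := by
  refine Filter.EventuallyEq.fderiv_eq ?_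
  have hc : Continuous fun z : Z => (z, α, (0 : ℝ)) := by fun_prop
  filter_upwards [hc.continuousAt.eventually_mem (hN.mem_nhds hz)] with w hw
  exact (hFN _ hw).symm

/-- A principal fundamental solution of the variational equation is the derivative of the flow, by
uniqueness for linear equations; this identifies the given monodromy operator. -/
theorem eq_fderiv_flow_of_variational {E : Type u} [NormedAddCommGroup E] [NormedSpace ℝ E]
    [FiniteDimensional ℝ E] {F : E → E} {φ : ℝ → E → E} {K : NNReal} (hφ : IsGlobalFlow F φ)
    (hK : LipschitzWith K F) (hF : ContDiff ℝ 1 F)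
    (hφ1 : ContDiff ℝ 1 fun p : ℝ × E => φ p.1 p.2) {x : E} {Φ : ℝ → E →L[ℝ] E}
    (h0 : Φ 0 = ContinuousLinearMap.id ℝ E)
    (hΦ : ∀ t, HasDerivAt Φ ((fderiv ℝ F (φ t x)).comp (Φ t)) t) (t : ℝ) :
    Φ t = fderiv ℝ (φ t) x := by
  have hlip : ∀ t, LipschitzWith K fun B : E →L[ℝ] E => (fderiv ℝ F (φ t x)).comp B := fun t => by
    refine LipschitzWith.of_dist_le_mul fun B C => ?_
    rw [dist_eq_norm, dist_eq_norm, ← ContinuousLinearMap.comp_sub]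
    exact (ContinuousLinearMap.opNorm_comp_le _ _).trans
      (mul_le_mul_of_nonneg_right (norm_fderiv_le_of_lipschitz ℝ hK) (norm_nonneg _))
  have h0' : fderiv ℝ (φ 0) x = ContinuousLinearMap.id ℝ E := by
    have : φ 0 = id := funext hφ.map_zero
    rw [this, fderiv_id]
  exact congrFun (ODE_solution_unique_univ (s := fun _ => univ) (t₀ := 0)
    (fun t => (hlip t).lipschitzOnWith) (fun t => ⟨hΦ t, mem_univ _⟩)
    (fun t => ⟨hφ.hasDerivAt_fderiv hF hφ1 t x, mem_univ _⟩) (h0.trans h0'.symm)) t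

theorem isHyperbolicLimitCycle_layer {Z : Type u} [NormedAddCommGroup Z] [NormedSpace ℝ Z]
    [FiniteDimensional ℝ Z] {F : Z × ℝ × ℝ → Z × ℝ × ℝ} {K : NNReal}
    {φ : ℝ → Z × ℝ × ℝ → Z × ℝ × ℝ} (hφ : IsGlobalFlow F φ) (hK : LipschitzWith K F)
    (hF : ContDiff ℝ 1 F) (hφ1 : ContDiff ℝ 1 fun p : ℝ × (Z × ℝ × ℝ) => φ p.1 p.2)
    (hF2 : ∀ p, (F p).2.2 = 0) (hF1 : ∀ p, p.2.2 = 0 → (F p).2.1 = 0)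
    {f : Z × ℝ × ℝ → Z} {N : Set (Z × ℝ × ℝ)} (hN : IsOpen N) (hFN : ∀ p ∈ N, (F p).1 = f p)
    {z : Z} {α T : ℝ} (hT : 0 < T) (hper : φ T (z, α, 0) = (z, α, 0))
    (hstay : ∀ t ∈ Icc 0 T, φ t (z, α, 0) ∈ N)
    (hmin : ∀ t ∈ Ioo 0 T, (φ t (z, α, 0)).1 ≠ z)
    (hhyp : ∀ μ ∈ nontrivialMultipliers 1 (fderiv ℝ (fun z => (φ T (z, α, 0)).1) z), ‖μ‖ ≠ 1) :
    IsHyperbolicLimitCycle (fun z => f (z, α, 0)) (fun t => (φ t (z, α, 0)).1) T := by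
  have hperiodic : ∀ t, φ (t + T) (z, α, 0) = φ t (z, α, 0) := fun t => by
    rw [hφ.map_add hK, hper]
  have hstay' : ∀ t, φ t (z, α, 0) ∈ N := fun t => by
    obtain ⟨s, hs, hst⟩ := Function.Periodic.exists_mem_Ico₀
      (f := fun t => φ t (z, α, 0)) hperiodic hT t
    change φ t (z, α, 0) = φ s (z, α, 0) at hst
    rw [hst]
    exact hstay s ⟨hs.1, hs.2.le⟩
  have hl := hφ.layer hF2 hF1 α
  have hmem : ∀ t, ((φ t (z, α, 0)).1, α, (0 : ℝ)) ∈ N := fun t => by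
    rw [← hφ.apply_layer hF2 hF1]
    exact hstay' t
  refine ⟨hT, fun t => ?_, fun t => congrArg Prod.fst (hperiodic t), fun t ht => ?_,
    fun t => fderiv ℝ (fun z => (φ t (z, α, 0)).1) z, ?_, fun t => ?_, hhyp⟩
  · have := hl.hasDerivAt t z
    rwa [hFN _ (hmem t)] at this
  · rw [hφ.map_zero]
    exact hmin t ht
  · have : (fun z => (φ 0 (z, α, 0)).1) = id := funext hl.map_zero
    change fderiv ℝ (fun z => (φ 0 (z, α, 0)).1) z = _
    rw [this, fderiv_id]
  · rw [fderiv_layer_eq hN hFN (hmem t)]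
    exact hl.hasDerivAt_fderiv (contDiff_layer hF α) (contDiff_layer_flow hφ1 α) t z

/-! ### Properties of the critical manifold -/

theorem fderiv_layerMap {X : Type*} [NormedAddCommGroup X] [NormedSpace ℝ X]
    {p : X × ℝ → X × ℝ} {x : X} {α : ℝ} (hp : DifferentiableAt ℝ p (x, α)) :
    fderiv ℝ (fun x => (p (x, α)).1) x =
      ((ContinuousLinearMap.fst ℝ _ _).comp (fderiv ℝ p (x, α))).comp (.inl ℝ _ _) :=
  (HasFDerivAt.comp x (f := fun x => (x, α)) (g := fun q => (p q).1) hp.hasFDerivAt.fst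
    (hasFDerivAt_prodMk_left x α)).fderiv

section CriticalManifold

variable {m : ℕ} {r : ℕ∞}

theorem isEmbeddedSubmanifold_graph (hr : 1 ≤ r) {φ : ℝ → EuclideanSpace ℝ (Fin m)} {Vα : Set ℝ}
    (hVα : IsOpen Vα) (hφ : ContDiffOn ℝ r φ Vα) :
    IsEmbeddedSubmanifold r 1 ((fun α => (φ α, α)) '' Vα) := by
  have hr1 : (1 : WithTop ℕ∞) ≤ r := by exact_mod_cast hr
  refine ⟨m, by simp [add_comm], ?_⟩
  rintro p ⟨α, hα, rfl⟩
  refine ⟨univ ×ˢ Vα, isOpen_univ.prod hVα, ⟨mem_univ _, hα⟩, fun z => z.1 - φ z.2, ?_, ?_, ?_⟩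
  · exact contDiffOn_fst.sub (hφ.comp contDiffOn_snd fun z hz => hz.2)
  · rintro ⟨x, a⟩ ⟨-, ha⟩ ξ
    have hd : HasFDerivAt φ (fderiv ℝ φ a) a :=
      ((hφ.contDiffAt (hVα.mem_nhds ha)).differentiableAt (by
        exact (zero_lt_one.trans_le hr1).ne')).hasFDerivAt
    have h : HasFDerivAt (fun z : EuclideanSpace ℝ (Fin m) × ℝ => z.1 - φ z.2)
        (.fst ℝ _ _ - (fderiv ℝ φ a).comp (.snd ℝ _ _)) (x, a) :=
      hasFDerivAt_fst.sub (HasFDerivAt.comp (x, a) (f := Prod.snd) hd hasFDerivAt_snd)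
    exact ⟨(ξ, 0), by rw [h.fderiv]; simp⟩
  · rintro ⟨x, a⟩ ⟨-, ha⟩
    rw [sub_eq_zero]
    constructor
    · rintro ⟨b, -, hb⟩
      obtain ⟨h1, rfl⟩ := Prod.ext_iff.1 hb
      exact h1.symm
    · rintro h
      exact ⟨a, ha, Prod.ext h.symm rfl⟩

/-- The layer map fixes `α`, so its increment is the fixed injection `x ↦ (x, 0)` applied to the
increment of the `x`-component, which is a submersion where `1` is not an eigenvalue. -/
theorem hasFactorisation_of_regular_fixedPoints {P : EuclideanSpace ℝ (Fin m) × ℝ → ℝ →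
      EuclideanSpace ℝ (Fin m) × ℝ} {U : Set (EuclideanSpace ℝ (Fin m) × ℝ)} (hU : IsOpen U)
    {φ : ℝ → EuclideanSpace ℝ (Fin m)} {Vα : Set ℝ} (hr : 1 ≤ r)
    (hP : ContDiffOn ℝ r (fun q => P q 0) U) (hα : ∀ q ∈ U, (P q 0).2 = q.2)
    (hS : ∀ q, q ∈ (fun α => (φ α, α)) '' Vα ↔ q ∈ U ∧ (P q 0).1 - q.1 = 0)
    (hinv : ∀ α ∈ Vα, (fderiv ℝ (fun x => (P (x, α) 0).1) (φ α) -
      ContinuousLinearMap.id ℝ _).IsInvertible) :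
    HasFactorisation r U (layerIncrement P) 1 ((fun α => (φ α, α)) '' Vα) := by
  have hh : ∀ q ∈ U, layerIncrement P q =
      ContinuousLinearMap.inl ℝ (EuclideanSpace ℝ (Fin m)) ℝ ((P q 0).1 - q.1) := fun q hq =>
    Prod.ext rfl (by simp [layerIncrement, hα q hq])
  refine ⟨m, by simp [add_comm], fun _ => .inl ℝ _ _, fun q => (P q 0).1 - q.1, contDiffOn_const,
    hP.fst.sub contDiffOn_fst, hh, fun z _ => ?_, fun z hz hzS h0 => ?_, ?_, ?_⟩
  · intro x y hxy
    exact congrArg Prod.fst hxy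
  · rw [hh z hz] at h0
    exact absurd ((hS z).2 ⟨hz, congrArg Prod.fst h0⟩) hzS
  · ext q
    exact hS q
  · rintro _ ⟨α, hαV, rfl⟩ ξ
    have hmem : (φ α, α) ∈ U := ((hS _).1 ⟨α, hαV, rfl⟩).1
    have hd := (hP.contDiffAt (hU.mem_nhds hmem)).differentiableAt (by
        have : (1 : WithTop ℕ∞) ≤ r := by exact_mod_cast hr
        exact (zero_lt_one.trans_le this).ne')
    obtain ⟨η, hη⟩ := (hinv α hαV).surjective ξ
    refine ⟨(η, 0), ?_⟩
    have h1 : HasFDerivAt (fun q : EuclideanSpace ℝ (Fin m) × ℝ => (P q 0).1 - q.1)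
        ((ContinuousLinearMap.fst ℝ _ _).comp (fderiv ℝ (fun q => P q 0) (φ α, α)) -
          .fst ℝ _ _) (φ α, α) := hd.hasFDerivAt.fst.sub hasFDerivAt_fst
    rw [h1.fderiv, ← hη, fderiv_layerMap hd]
    rfl

theorem charpoly_layerMap {X : Type*} [NormedAddCommGroup X] [NormedSpace ℝ X]
    [FiniteDimensional ℝ X] {p : X × ℝ → X × ℝ} {x : X} {α : ℝ}
    (hp : DifferentiableAt ℝ p (x, α)) (hα : ∀ᶠ q in 𝓝 (x, α), (p q).2 = q.2) :
    ((fderiv ℝ p (x, α) : X × ℝ →L[ℝ] X × ℝ) : X × ℝ →ₗ[ℝ] X × ℝ).charpoly =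
      ((fderiv ℝ (fun x => (p (x, α)).1) x : X →L[ℝ] X) : X →ₗ[ℝ] X).charpoly *
        (Polynomial.X - Polynomial.C 1) := by
  have h2 : (ContinuousLinearMap.snd ℝ X ℝ).comp (fderiv ℝ p (x, α)) = .snd ℝ X ℝ :=
    (hp.hasFDerivAt.snd.congr_of_eventuallyEq (hα.mono fun _ h => h.symm)).unique hasFDerivAt_snd
  have h3 : ∀ v, (fderiv ℝ p (x, α) v).2 = v.2 := fun v => congrArg (fun B => B v) h2
  refine charpoly_upperTriangular _ _ (fun ξ => ?_) (h3 _)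
  rw [fderiv_layerMap hp]
  exact Prod.ext rfl (h3 _)

end CriticalManifold

/-- There are no non-constant closed orbits on a line: the velocity would vanish somewhere. -/
theorem ne_zero_of_closedOrbit {m : ℕ} {F : EuclideanSpace ℝ (Fin m) × ℝ →
      EuclideanSpace ℝ (Fin m) × ℝ} {K : NNReal} (hK : LipschitzWith K F)
    {γ : ℝ → EuclideanSpace ℝ (Fin m) × ℝ} {T : ℝ} (hT : 0 < T)
    (hγ : ∀ t, HasDerivAt γ (F (γ t)) t) (hper : γ T = γ 0) (hmin : ∀ t ∈ Ioo 0 T, γ t ≠ γ 0) :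
    m ≠ 0 := by
  rintro rfl
  have hd : ∀ t, HasDerivAt (fun t => (γ t).2) (F (γ t)).2 t := fun t => (hγ t).snd
  obtain ⟨c, -, hc⟩ := exists_hasDerivAt_eq_zero (f := fun t => (γ t).2) hT
    (fun t _ => (hd t).continuousAt.continuousWithinAt) (by simp [hper]) (fun t _ => hd t)
  have hFc : F (γ c) = 0 := Prod.ext (Subsingleton.elim _ _) hc
  have hconst : (fun _ => γ c) = γ := ODE_solution_unique_univ (v := fun _ => F)
    (s := fun _ => univ) (t₀ := c) (fun _ => hK.lipschitzOnWith)
    (fun t => ⟨by rw [hFc]; exact hasDerivAt_const t _, mem_univ _⟩)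
    (fun t => ⟨hγ t, mem_univ _⟩) rfl
  exact hmin (T / 2) ⟨by linarith, by linarith⟩ (by rw [← hconst])

/-! ### Closed orbits as fixed points of the return map -/

section Layer

variable {X : Type u} [NormedAddCommGroup X] [NormedSpace ℝ X]
  {r : ℕ∞} {F : (X × ℝ) × ℝ × ℝ → (X × ℝ) × ℝ × ℝ} {K : NNReal}
  {φ : ℝ → (X × ℝ) × ℝ × ℝ → (X × ℝ) × ℝ × ℝ} {Y : X × ℝ → ℝ}
  {N : Set ((X × ℝ) × ℝ × ℝ)} {W : Set (X × ℝ)} {P : X × ℝ → ℝ → X × ℝ} {τ : X × ℝ → ℝ → ℝ}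

theorem ReturnsAt.snd_eq {q : X × ℝ} (h : ReturnsAt r φ Y N W P τ (q, 0)) (hφ : IsGlobalFlow F φ)
    (hF2 : ∀ p, (F p).2.2 = 0) (hF1 : ∀ p, p.2.2 = 0 → (F p).2.1 = 0) : (P q 0).2 = q.2 := by
  have h1 := congrArg (fun z => z.2.1) h.eq
  have h2 := hφ.alpha_const hF2 hF1 (τ q 0) (p := extendedSectionPoint Y (q, 0)) rfl
  exact h1.symm.trans h2

theorem ReturnsAt.contDiffAt_layer {q : X × ℝ} (h : ReturnsAt r φ Y N W P τ (q, 0)) :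
    ContDiffAt ℝ r (fun q => P q 0) q :=
  h.contDiffAt_map.comp q (f := fun q => (q, (0 : ℝ))) (by fun_prop)

theorem ReturnsAt.contDiffAt_layer_time {q : X × ℝ} (h : ReturnsAt r φ Y N W P τ (q, 0)) :
    ContDiffAt ℝ r (fun q => τ q 0) q :=
  h.contDiffAt_time.comp q (f := fun q => (q, (0 : ℝ))) (by fun_prop)

theorem charpoly_monodromy_layer [FiniteDimensional ℝ X] (hr : 1 ≤ r) (hφ : IsGlobalFlow F φ)
    (hK : LipschitzWith K F) (hφ1 : ContDiff ℝ 1 fun p : ℝ × ((X × ℝ) × ℝ × ℝ) => φ p.1 p.2)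
    (hF2 : ∀ p, (F p).2.2 = 0) (hF1 : ∀ p, p.2.2 = 0 → (F p).2.1 = 0) (hY : ContDiff ℝ 1 Y)
    {x : X} {α : ℝ} (hret : ∀ᶠ p in 𝓝 ((x, α), (0 : ℝ)), ReturnsAt r φ Y N W P τ p)
    (hfix : P (x, α) 0 = (x, α))
    (htr : (F (extendedSectionPoint Y ((x, α), 0))).1.2 ≠
      fderiv ℝ Y (x, α) ((F (extendedSectionPoint Y ((x, α), 0))).1.1, 0)) :
    ((fderiv ℝ (fun z => (φ (τ (x, α) 0) (z, α, 0)).1) (x, Y (x, α)) : X × ℝ →L[ℝ] X × ℝ) :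
      X × ℝ →ₗ[ℝ] X × ℝ).charpoly =
      ((fderiv ℝ (fun x => (P (x, α) 0).1) x : X →L[ℝ] X) : X →ₗ[ℝ] X).charpoly *
        (Polynomial.X - Polynomial.C 1) := by
  have hr0 : (r : WithTop ℕ∞) ≠ 0 := by
    have : r ≠ 0 := (zero_lt_one.trans_le hr).ne'
    exact_mod_cast this
  have hc : Continuous fun x : X => ((x, α), (0 : ℝ)) := by fun_prop
  have hx : DifferentiableAt ℝ (fun x : X => (x, α)) x := by fun_prop
  have hYd : HasFDerivAt (fun x => Y (x, α)) ((fderiv ℝ Y (x, α)).comp (.inl ℝ _ _)) x :=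
    HasFDerivAt.comp x (f := fun x => (x, α))
      (hY.differentiable one_ne_zero).differentiableAt.hasFDerivAt (hasFDerivAt_prodMk_left x α)
  refine charpoly_monodromy (hφ.layer hF2 hF1 α) (lipschitzWith_layer hK α)
    (contDiff_layer_flow hφ1 α) (Y := fun x => Y (x, α)) (τ := fun x => τ (x, α) 0)
    (Px := fun x => (P (x, α) 0).1) hYd.differentiableAt ?_ ?_ ?_ ?_ ?_
  · exact ((hret.self_of_nhds.contDiffAt_layer_time).differentiableAt hr0).comp x
      (f := fun x => (x, α)) hx
  · exact (((hret.self_of_nhds.contDiffAt_layer).differentiableAt hr0).comp x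
      (f := fun x => (x, α)) hx).fst
  · rw [hfix]
  · filter_upwards [hc.continuousAt.eventually hret] with y hy
    have h1 := congrArg Prod.fst hy.eq
    have h2 : P (y, α) 0 = ((P (y, α) 0).1, α) := Prod.ext rfl (hy.snd_eq hφ hF2 hF1)
    exact h1.trans (Prod.ext rfl (congrArg Y h2))
  · rw [hYd.fderiv]
    exact htr

/-- Over `W` a closed orbit of the layer problem meets the section at its base point only: modulo
the period, a second crossing would contradict the first-return property. -/
theorem ReturnsAt.eq_of_mem_orbit {q q' : X × ℝ} (h : ReturnsAt r φ Y N W P τ (q, 0))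
    (hφ : IsGlobalFlow F φ) (hK : LipschitzWith K F) (hF2 : ∀ p, (F p).2.2 = 0)
    (hF1 : ∀ p, p.2.2 = 0 → (F p).2.1 = 0) (hfix : P q 0 = q) (hq' : q' ∈ W) (hα : q'.2 = q.2)
    {t : ℝ} (ht : (φ t (extendedSectionPoint Y (q, 0))).1 = (q'.1, Y q')) : q' = q := by
  have hper : ∀ t, φ (t + τ q 0) (extendedSectionPoint Y (q, 0)) =
      φ t (extendedSectionPoint Y (q, 0)) := fun t => by
    have := h.eq
    simp only [hfix] at this
    rw [hφ.map_add hK, this]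
  obtain ⟨s, hs, hst⟩ := Function.Periodic.exists_mem_Ico₀
    (f := fun t => φ t (extendedSectionPoint Y (q, 0))) hper h.time_pos t
  change φ t _ = φ s _ at hst
  rw [hst] at ht
  rcases hs.1.eq_or_lt with h0 | h0
  · rw [← h0, hφ.map_zero] at ht
    have h1 : q.1 = q'.1 := (Prod.ext_iff.1 ht).1
    exact (Prod.ext h1 hα.symm).symm
  · refine absurd ?_ (h.first s ⟨h0, hs.2⟩ q' hq' ht)
    rw [hφ.alpha_const hF2 hF1 s rfl, hα]
    rfl

/-- Where the truncated field is the given one, the return of the extended flow is a first return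
of the fast-slow system. -/
theorem ReturnsAt.isFirstReturn {f : (X × ℝ) × ℝ × ℝ → X × ℝ} {g : (X × ℝ) × ℝ × ℝ → ℝ} {q : X × ℝ}
    {ε : ℝ} (h : ReturnsAt r φ Y N W P τ (q, ε)) (hφ : IsGlobalFlow F φ)
    (hF2 : ∀ p, (F p).2.2 = 0) (hFN : ∀ p ∈ N, F p = (f p, p.2.2 * g p, 0)) :
    IsFirstReturn (fastSlowField f g ε) (crossSection Y W) (sectionPoint Y q)
      (sectionPoint Y (P q ε)) := by
  set p := extendedSectionPoint Y (q, ε) with hp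
  refine ⟨τ q ε, h.time_pos, fun t => ((φ t p).1, (φ t p).2.1), ?_, fun t ht => ?_, fun t ht => ?_,
    ?_, ⟨_, h.mem, rfl⟩⟩
  · simp only [hφ.map_zero]
    rfl
  · have hd := hφ.hasDerivAt t p
    rw [hFN _ (h.stays t ht)] at hd
    have h1 : HasDerivAt (fun t => ((φ t p).1, (φ t p).2.1)) (f (φ t p), (φ t p).2.2 * g (φ t p)) t :=
      hd.fst.prodMk hd.snd.fst
    have h2 : (φ t p).2.2 = ε := hφ.epsilon_const hF2 t p
    have h3 : ((φ t p).1, (φ t p).2.1, ε) = φ t p := Prod.ext rfl (Prod.ext rfl h2.symm)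
    simp only [fastSlowField, h3]
    rw [h2] at h1
    exact h1.hasDerivWithinAt
  · rintro ⟨q', hq', hq'e⟩
    exact h.first t ht q' hq' (congrArg Prod.fst hq'e).symm (congrArg Prod.snd hq'e).symm
  · simp only [hp, h.eq]
    rfl

end Layer

theorem exists_bound_of_periodic {E : Type*} [NormedAddCommGroup E] {γ : ℝ → E} {T : ℝ} (hT : 0 < T)
    (hc : Continuous γ) (hper : ∀ t, γ (t + T) = γ t) : ∃ C, ∀ t, ‖γ t‖ ≤ C := by
  obtain ⟨C, hC⟩ := (isCompact_Icc (a := 0) (b := T)).exists_bound_of_continuousOn hc.continuousOn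
  refine ⟨C, fun t => ?_⟩
  obtain ⟨s, hs, hst⟩ := Function.Periodic.exists_mem_Ico₀ hper hT t
  rw [hst]
  exact hC s ⟨hs.1, hs.2.le⟩

/-! ### The fast-slow map of a hyperbolic limit cycle -/

theorem lemma5p3 {m : ℕ} {r : ℕ∞} (hr : 1 ≤ r) {ε₀ : ℝ} (hε₀ : 0 < ε₀)
    (f : (EuclideanSpace ℝ (Fin m) × ℝ) × ℝ × ℝ → EuclideanSpace ℝ (Fin m) × ℝ)
    (g : (EuclideanSpace ℝ (Fin m) × ℝ) × ℝ × ℝ → ℝ)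
    (hf : ContDiffOn ℝ r f (univ ×ˢ univ ×ˢ Ioo (-ε₀) ε₀))
    (hg : ContDiffOn ℝ r g (univ ×ˢ univ ×ˢ Ioo (-ε₀) ε₀))
    -- the hyperbolic limit cycle of the layer problem at `α = αs`
    (αs Ts : ℝ) (γs : ℝ → EuclideanSpace ℝ (Fin m) × ℝ)
    (hγs : IsHyperbolicLimitCycle (fun z => f (z, αs, 0)) γs Ts)
    -- the hypersurface `y = Y (x, α)` passes through the cycle, transversally to the flow
    (Y : EuclideanSpace ℝ (Fin m) × ℝ → ℝ) (hY : ContDiff ℝ r Y)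
    (xs : EuclideanSpace ℝ (Fin m)) (hxs : γs 0 = (xs, Y (xs, αs)))
    (htrans : fastSlowField f g 0 (sectionPoint Y (xs, αs)) ∉
      range (fderiv ℝ (sectionPoint Y) (xs, αs))) :
    ∀ O ∈ 𝓝 (xs, αs),
    ∃ (W : Set (EuclideanSpace ℝ (Fin m) × ℝ)) (Vx : Set (EuclideanSpace ℝ (Fin m)))
      (Vα : Set ℝ) (ε₁ : ℝ) (γ : ℝ → ℝ → EuclideanSpace ℝ (Fin m) × ℝ) (T : ℝ → ℝ)
      (φ : ℝ → EuclideanSpace ℝ (Fin m))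
      (P : EuclideanSpace ℝ (Fin m) × ℝ → ℝ → EuclideanSpace ℝ (Fin m) × ℝ),
      IsOpen W ∧ W ⊆ O ∧
      IsOpen Vx ∧ xs ∈ Vx ∧ IsOpen Vα ∧ Vα.OrdConnected ∧ αs ∈ Vα ∧ Vx ×ˢ Vα ⊆ W ∧
      0 < ε₁ ∧ ε₁ ≤ ε₀ ∧
      -- the manifold of hyperbolic limit cycles through the given one
      (∀ α ∈ Vα, IsHyperbolicLimitCycle (fun z => f (z, α, 0)) (γ α) (T α)) ∧
      γ αs = γs ∧ T αs = Ts ∧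
      ContDiffOn ℝ r T Vα ∧
      ContDiffOn ℝ r (fun p : ℝ × ℝ => γ p.1 p.2) (Vα ×ˢ univ) ∧
      -- its intersection with the cross-section is a graph over `Vα`
      ContDiffOn ℝ r φ Vα ∧ MapsTo φ Vα Vx ∧
      crossSection Y W ∩ cycleManifold γ Vα =
        sectionPoint Y '' ((fun α => (φ α, α)) '' Vα) ∧
      -- `P` is the first return map to the cross-section, in the coordinates `(x, α)`
      (∀ q ∈ Vx ×ˢ Vα, ∀ ε ∈ Ioo (-ε₁) ε₁,
        IsFirstReturn (fastSlowField f g ε) (crossSection Y W)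
          (sectionPoint Y q) (sectionPoint Y (P q ε))) ∧
      -- it is a fast-slow map, with the intersection as normally hyperbolic critical manifold
      IsFastSlowMap r (Vx ×ˢ Vα) ε₁ P 1 ((fun α => (φ α, α)) '' Vα) ∧
      HasFactorisation r (Vx ×ˢ Vα) (layerIncrement P) 1 ((fun α => (φ α, α)) '' Vα) ∧
      IsNormallyHyperbolic P 1 ((fun α => (φ α, α)) '' Vα) := by
  intro O hO
  have hr1 : (1 : WithTop ℕ∞) ≤ r := by exact_mod_cast hr
  have hr0 : (r : WithTop ℕ∞) ≠ 0 := (zero_lt_one.trans_le hr1).ne'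
  obtain ⟨hTs, hsol, hperiodic, hmin, Φ, hΦ0, hΦ, hΦhyp⟩ := hγs
  have hγc : Continuous γs := continuous_iff_continuousAt.2 fun t => (hsol t).continuousAt
  obtain ⟨C, hC⟩ := exists_bound_of_periodic hTs hγc hperiodic
  have hC0 : 0 ≤ C := (norm_nonneg _).trans (hC 0)
  -- replace the system by a complete one that agrees with it near the cycle
  obtain ⟨F, K, ϕ, N, hF, hK, hϕ, hF2, hF1, hN, hmemN, hFN⟩ :=
    exists_truncation hr hε₀ hf hg (R := C + |αs| + 1) (by positivity)
  have hFN1 : ∀ p ∈ N, (F p).1 = f p := fun p hp => by rw [hFN p hp]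
  have hϕr := hϕ.contDiff hr hF hK
  have hϕ1 := hϕr.of_le hr1
  have hmemγ : ∀ t, (γs t, αs, (0 : ℝ)) ∈ N := fun t =>
    hmemN _ _ ((hC t).trans_lt (by linarith [abs_nonneg αs])) (by linarith)
  have hext : extendedSectionPoint Y ((xs, αs), 0) = (γs 0, αs, 0) := by rw [hxs]; rfl
  have hϕγ : ∀ t, ϕ t (γs 0, αs, 0) = (γs t, αs, 0) := by
    refine fun t => hϕ.eq_of_integralCurve hK (γ := fun t => (γs t, αs, (0 : ℝ))) (fun t => ?_) t
    rw [hFN _ (hmemγ t)]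
    simpa using (hsol t).prodMk ((hasDerivAt_const t αs).prodMk (hasDerivAt_const t (0 : ℝ)))
  have hγT : γs Ts = γs 0 := by simpa using hperiodic 0
  have htr : (F (extendedSectionPoint Y ((xs, αs), 0))).1.2 ≠
      fderiv ℝ Y (xs, αs) ((F (extendedSectionPoint Y ((xs, αs), 0))).1.1, 0) := by
    have hmem : extendedSectionPoint Y ((xs, αs), 0) ∈ N := by rw [hext]; exact hmemγ 0
    rw [hFN1 _ hmem]
    intro h
    refine htrans ⟨((f (extendedSectionPoint Y ((xs, αs), 0))).1, 0), ?_⟩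
    have hd : HasFDerivAt (sectionPoint Y)
        (((ContinuousLinearMap.fst ℝ _ _).prod (fderiv ℝ Y (xs, αs))).prod (.snd ℝ _ _)) (xs, αs) :=
      (hasFDerivAt_fst.prodMk ((hY.of_le hr1).differentiable
        one_ne_zero).differentiableAt.hasFDerivAt).prodMk hasFDerivAt_snd
    rw [hd.fderiv]
    exact Prod.ext (Prod.ext rfl h.symm) (by simp [fastSlowField])
  obtain ⟨W, P, τ, hW, hWO, hqW, hτs, hPs, hret⟩ := exists_returnMap hr hϕ hϕr hF2 hF1 hY hN
    (q₀ := (xs, αs)) hTs (by rw [hext, hϕγ, hγT])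
    (fun t ht => by rw [hext, hϕγ, ← hxs]; exact hmin t ht) htr
    (fun t => by rw [hext, hϕγ]; exact hmemγ t) hO
  -- without an `x`-coordinate there are no closed orbits, so `1 < m + 1`
  have hm : m ≠ 0 := ne_zero_of_closedOrbit (lipschitzWith_layer hK αs) hTs
    (fun t => by rw [hFN1 _ (hmemγ t)]; exact hsol t) hγT hmin
  -- the linearised return map, and its hyperbolicity at the given cycle
  let A : ℝ → EuclideanSpace ℝ (Fin m) → EuclideanSpace ℝ (Fin m) →L[ℝ] EuclideanSpace ℝ (Fin m) :=
    fun α x => fderiv ℝ (fun x => (P (x, α) 0).1) x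
  have hmono : Φ Ts = fderiv ℝ (fun z => (ϕ (τ (xs, αs) 0) (z, αs, 0)).1) (xs, Y (xs, αs)) := by
    rw [hτs, ← hxs]
    refine eq_fderiv_flow_of_variational (hϕ.layer hF2 hF1 αs) (lipschitzWith_layer hK αs)
      (contDiff_layer (hF.of_le hr1) αs) (contDiff_layer_flow hϕ1 αs) hΦ0 (fun t => ?_) Ts
    have := hΦ t
    rw [fderiv_layer_eq hN hFN1 (hmemγ t)] at this
    rw [hϕγ]
    exact this
  have hAs : ∀ μ ∈ multipliers (A αs xs), ‖μ‖ ≠ 1 := by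
    rw [← multipliers_eq_of_charpoly_eq (charpoly_monodromy_layer hr hϕ hK hϕ1 hF2 hF1
      (hY.of_le hr1) hret hPs htr), ← hmono]
    exact hΦhyp
  have hcl : Continuous fun q : EuclideanSpace ℝ (Fin m) × ℝ => (q, (0 : ℝ)) := by fun_prop
  have hret0 : ∀ᶠ q in 𝓝 (xs, αs), ReturnsAt r ϕ Y N W P τ (q, 0) :=
    hcl.continuousAt.eventually hret
  -- the fixed points of the layer map
  obtain ⟨φ, hφs, hφr, hφiff⟩ : ∃ φ : ℝ → EuclideanSpace ℝ (Fin m), φ αs = xs ∧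
      (∀ᶠ α in 𝓝 αs, ContDiffAt ℝ r φ α) ∧
      ∀ᶠ v : ℝ × EuclideanSpace ℝ (Fin m) in 𝓝 (αs, xs),
        (P (v.2, v.1) 0).1 - v.2 = 0 ↔ v.2 = φ v.1 := by
    have hsw : ∀ v : ℝ × EuclideanSpace ℝ (Fin m), ContDiffAt ℝ r Prod.swap v := fun v =>
      (contDiff_snd.prodMk contDiff_fst).contDiffAt
    have hd : ∀ᶠ v : ℝ × EuclideanSpace ℝ (Fin m) in 𝓝 (αs, xs),
        ContDiffAt ℝ r (fun v => (P (v.2, v.1) 0).1 - v.2) v := by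
      filter_upwards [(continuous_swap.tendsto (αs, xs)).eventually hret0] with v hv
      exact (hv.contDiffAt_layer.comp v (hsw v)).fst.sub contDiffAt_snd
    refine exists_implicitFunction hr hd (by rw [hPs, sub_self]) ?_
    have h1 := (hd.self_of_nhds.differentiableAt hr0).hasFDerivAt.comp xs
      (hasFDerivAt_prodMk_right αs xs)
    have h2 : HasFDerivAt (fun x => (P (x, αs) 0).1 - x) (A αs xs - .id ℝ _) xs := by
      have h3 : DifferentiableAt ℝ (fun x => (P (x, αs) 0).1) xs :=
        ((hret0.self_of_nhds.contDiffAt_layer.differentiableAt hr0).comp xs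
          (f := fun x => (x, αs)) (by fun_prop)).fst
      exact h3.hasFDerivAt.sub (hasFDerivAt_id xs)
    rw [h1.unique h2]
    exact isInvertible_sub_id_of_multipliers hAs
  have hφc : ContinuousAt φ αs := hφr.self_of_nhds.continuousAt
  have hgraph : Filter.Tendsto (fun α => (φ α, α)) (𝓝 αs) (𝓝 (xs, αs)) := by
    have := (hφc.prodMk continuousAt_id).tendsto
    rwa [hφs] at this
  have hhyp : ∀ᶠ α in 𝓝 αs, ∀ μ ∈ multipliers (A α (φ α)), ‖μ‖ ≠ 1 := by
    refine eventually_multipliers_off_circle (A := fun α => A α (φ α)) ?_ (by rwa [hφs])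
    have h1 : ContinuousAt (fun q => ((ContinuousLinearMap.fst ℝ _ _).comp
        (fderiv ℝ (fun q => P q 0) q)).comp (.inl ℝ (EuclideanSpace ℝ (Fin m)) ℝ)) (xs, αs) :=
      (continuousAt_const.clm_comp ((hret0.self_of_nhds.contDiffAt_layer.of_le
        hr1).continuousAt_fderiv one_ne_zero)).clm_comp continuousAt_const
    have h2 := ContinuousAt.comp_of_eq (f := fun α => (φ α, α)) h1
      (hφc.prodMk continuousAt_id) (by rw [hφs])
    refine h2.congr ?_
    filter_upwards [hgraph.eventually hret0] with α hα
    exact (fderiv_layerMap (hα.contDiffAt_layer.differentiableAt hr0)).symm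
  have htr' : ∀ᶠ α in 𝓝 αs, (F (extendedSectionPoint Y ((φ α, α), 0))).1.2 ≠
      fderiv ℝ Y (φ α, α) ((F (extendedSectionPoint Y ((φ α, α), 0))).1.1, 0) := by
    have hFS : Continuous fun q => (F (extendedSectionPoint Y (q, 0))).1 :=
      continuous_fst.comp (hF.continuous.comp
        ((contDiff_extendedSectionPoint hY).continuous.comp hcl))
    have h1 : Continuous fun q => fderiv ℝ Y q ((F (extendedSectionPoint Y (q, 0))).1.1, 0) :=
      ((hY.of_le hr1).continuous_fderiv one_ne_zero).clm_apply
        ((continuous_fst.comp hFS).prodMk continuous_const)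
    have ho : IsOpen {q | (F (extendedSectionPoint Y (q, 0))).1.2 ≠
        fderiv ℝ Y q ((F (extendedSectionPoint Y (q, 0))).1.1, 0)} :=
      isOpen_ne_fun (continuous_snd.comp hFS) h1
    exact hgraph.eventually (ho.mem_nhds htr)
  -- the integral in the expansion needs a globally smooth extension of `P`
  obtain ⟨H, hHr, hHP⟩ := exists_contDiff_eventuallyEq
    (hret.mono fun p hp => hp.contDiffAt_map)
  obtain ⟨G, hG, hHG⟩ := exists_expansion hr hHr
  -- one radius `ρ` works for `x`, `α` and `ε`; then `α` is restricted further to keep `φ α` in `Vx`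
  have hgood : ∀ᶠ p in 𝓝 ((xs, αs), (0 : ℝ)),
      ReturnsAt r ϕ Y N W P τ p ∧ H p = P p.1 p.2 ∧ p.1 ∈ W :=
    hret.and (hHP.and (continuous_fst.continuousAt.eventually_mem (hW.mem_nhds hqW)))
  obtain ⟨ρ₁, hρ₁, hgood⟩ := Metric.eventually_nhds_iff_ball.1 hgood
  obtain ⟨ρ₂, hρ₂, hφiff⟩ := Metric.eventually_nhds_iff_ball.1 hφiff
  let ρ := min ε₀ (min ρ₁ ρ₂)
  have hρ : 0 < ρ := lt_min hε₀ (lt_min hρ₁ hρ₂)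
  have hρle₁ : ρ ≤ ρ₁ := (min_le_right _ _).trans (min_le_left _ _)
  have hρle₂ : ρ ≤ ρ₂ := (min_le_right _ _).trans (min_le_right _ _)
  let Vx := Metric.ball xs ρ
  obtain ⟨η, hη, hαgood⟩ := Metric.eventually_nhds_iff_ball.1 (hφr.and (hhyp.and (htr'.and
    (hφc.eventually_mem (by rw [hφs]; exact Metric.ball_mem_nhds xs hρ : Vx ∈ 𝓝 (φ αs))))))
  let Vα := Metric.ball αs (min η ρ)
  have hVα : Vα ⊆ Metric.ball αs ρ := Metric.ball_subset_ball (min_le_right _ _)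
  have hVα' : ∀ α ∈ Vα, _ := fun α hα =>
    hαgood α (Metric.ball_subset_ball (min_le_left _ _) hα)
  have hVαo : IsOpen Vα := Metric.isOpen_ball
  have hUo : IsOpen (Vx ×ˢ Vα) := Metric.isOpen_ball.prod hVαo
  have hαsV : αs ∈ Vα := Metric.mem_ball_self (lt_min hη hρ)
  have hgoodU : ∀ q ∈ Vx ×ˢ Vα, ∀ ε ∈ Ioo (-ρ) ρ,
      ReturnsAt r ϕ Y N W P τ (q, ε) ∧ H (q, ε) = P q ε ∧ q ∈ W := by
    intro q hq ε hε
    refine hgood (q, ε) (Metric.ball_subset_ball hρle₁ ?_)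
    rw [Metric.mem_ball, Prod.dist_eq, Prod.dist_eq, Real.dist_0_eq_abs]
    exact max_lt (max_lt hq.1 (hVα hq.2)) (abs_lt.2 hε)
  have h0ρ : (0 : ℝ) ∈ Ioo (-ρ) ρ := ⟨by linarith, hρ⟩
  have hiffU : ∀ q ∈ Vx ×ˢ Vα, (P q 0).1 - q.1 = 0 ↔ q.1 = φ q.2 := by
    intro q hq
    refine hφiff (q.2, q.1) (Metric.ball_subset_ball hρle₂ ?_)
    rw [Metric.mem_ball, Prod.dist_eq]
    exact max_lt (hVα hq.2) hq.1
  have hgraphU : ∀ α ∈ Vα, (φ α, α) ∈ Vx ×ˢ Vα := fun α hα => ⟨(hVα' α hα).2.2.2, hα⟩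
  have hsnd : ∀ q ∈ Vx ×ˢ Vα, (P q 0).2 = q.2 := fun q hq =>
    (hgoodU q hq 0 h0ρ).1.snd_eq hϕ hF2 hF1
  have hfix : ∀ α ∈ Vα, P (φ α, α) 0 = (φ α, α) := fun α hα =>
    Prod.ext (sub_eq_zero.1 ((hiffU _ (hgraphU α hα)).2 rfl)) (hsnd _ (hgraphU α hα))
  have hretα : ∀ α ∈ Vα, ∀ᶠ p in 𝓝 ((φ α, α), (0 : ℝ)), ReturnsAt r ϕ Y N W P τ p := by
    intro α hα
    filter_upwards [(hUo.prod isOpen_Ioo).mem_nhds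
      (⟨hgraphU α hα, h0ρ⟩ : ((φ α, α), (0 : ℝ)) ∈ (Vx ×ˢ Vα) ×ˢ Ioo (-ρ) ρ)] with p hp
    exact (hgoodU p.1 hp.1 p.2 hp.2).1
  have hφon : ContDiffOn ℝ r φ Vα := fun α hα => (hVα' α hα).1.contDiffWithinAt
  have hgr : ContDiffOn ℝ r (fun α => (φ α, α)) Vα := hφon.prodMk contDiffOn_id
  have hPon : ContDiffOn ℝ r (fun p : (EuclideanSpace ℝ (Fin m) × ℝ) × ℝ => P p.1 p.2)
      ((Vx ×ˢ Vα) ×ˢ Ioo (-ρ) ρ) := fun p hp =>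
    (hgoodU p.1 hp.1 p.2 hp.2).1.contDiffAt_map.contDiffWithinAt
  have hPon0 : ContDiffOn ℝ r (fun q => P q 0) (Vx ×ˢ Vα) := fun q hq =>
    (hgoodU q hq 0 h0ρ).1.contDiffAt_layer.contDiffWithinAt
  have hS : ∀ q, q ∈ (fun α => (φ α, α)) '' Vα ↔ q ∈ Vx ×ˢ Vα ∧ (P q 0).1 - q.1 = 0 := by
    intro q
    constructor
    · rintro ⟨α, hα, rfl⟩
      exact ⟨hgraphU α hα, (hiffU _ (hgraphU α hα)).2 rfl⟩
    · rintro ⟨hq, h⟩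
      exact ⟨q.2, hq.2, Prod.ext ((hiffU q hq).1 h).symm rfl⟩
  refine ⟨W, Vx, Vα, ρ, fun α t => (ϕ t (extendedSectionPoint Y ((φ α, α), 0))).1,
    fun α => τ (φ α, α) 0, φ, P, hW, hWO, Metric.isOpen_ball, Metric.mem_ball_self hρ, hVαo, ?_,
    hαsV, fun q hq => (hgoodU q hq 0 h0ρ).2.2, hρ, min_le_left _ _, ?_, ?_, ?_, ?_, ?_, hφon,
    fun α hα => (hgraphU α hα).1, ?_, ?_, ?_, ?_, ?_⟩
  · exact (convex_ball αs _).ordConnected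
  · intro α hα
    have hR := (hretα α hα).self_of_nhds
    have hper := hR.eq
    simp only [hfix α hα] at hper
    refine isHyperbolicLimitCycle_layer hϕ hK (hF.of_le hr1) hϕ1 hF2 hF1 hN hFN1 hR.time_pos hper
      hR.stays (fun t ht h => ?_) ?_
    · refine hR.first t ht _ (hgoodU _ (hgraphU α hα) 0 h0ρ).2.2 h ?_
      rw [hϕ.alpha_const hF2 hF1 t rfl]
      rfl
    · rw [multipliers_eq_of_charpoly_eq (charpoly_monodromy_layer hr hϕ hK hϕ1 hF2 hF1
        (hY.of_le hr1) (hretα α hα) (hfix α hα) (hVα' α hα).2.2.1)]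
      exact (hVα' α hα).2.1
  · funext t
    simp only [hφs, hext, hϕγ]
  · simp only [hφs, hτs]
  · intro α hα
    exact ((hgoodU _ (hgraphU α hα) 0 h0ρ).1.contDiffAt_layer_time.comp_contDiffWithinAt α
      (f := fun α => (φ α, α)) (hgr α hα))
  · have h1 : ContDiffOn ℝ r (fun p : ℝ × ℝ => extendedSectionPoint Y ((φ p.1, p.1), 0))
        (Vα ×ˢ univ) :=
      (contDiff_extendedSectionPoint hY).comp_contDiffOn
        ((hgr.comp contDiffOn_fst fun p hp => hp.1).prodMk contDiffOn_const)
    exact (hϕr.comp_contDiffOn (contDiffOn_snd.prodMk h1)).fst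
  · ext p
    constructor
    · rintro ⟨⟨q, hq, rfl⟩, hα, t, ht⟩
      have hα' : q.2 ∈ Vα := hα
      have := (hgoodU _ (hgraphU _ hα') 0 h0ρ).1.eq_of_mem_orbit hϕ hK hF2 hF1
        (hfix _ hα') hq rfl ht
      exact ⟨q, ⟨q.2, hα', this.symm⟩, rfl⟩
    · rintro ⟨_, ⟨α, hα, rfl⟩, rfl⟩
      refine ⟨⟨_, (hgoodU _ (hgraphU α hα) 0 h0ρ).2.2, rfl⟩, hα, 0, ?_⟩
      simp only [hϕ.map_zero]
      rfl
  · intro q hq ε hε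
    exact (hgoodU q hq ε hε).1.isFirstReturn hϕ hF2 hFN
  · refine ⟨hPon, ⟨fun z ε => G (z, ε), hG.contDiffOn, fun z hz ε hε => ?_⟩, ?_, ?_, ?_, ?_, ?_⟩
    · rw [← (hgoodU z hz ε hε).2.1, hHG, (hgoodU z hz 0 h0ρ).2.1]
      simp [layerIncrement]
    · rintro _ ⟨α, hα, rfl⟩
      exact hgraphU α hα
    · rintro _ ⟨α, hα, rfl⟩
      rw [layerIncrement, hfix α hα, sub_self]
    · simpa using Nat.pos_of_ne_zero hm
    · exact isEmbeddedSubmanifold_graph hr hVαo hφon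
    · exact ((convex_ball αs _).isConnected ⟨αs, hαsV⟩).image _ hgr.continuousOn
  · exact hasFactorisation_of_regular_fixedPoints hUo hr hPon0 hsnd hS fun α hα =>
      isInvertible_sub_id_of_multipliers (hVα' α hα).2.1
  · rintro _ ⟨α, hα, rfl⟩
    have hd := (hgoodU _ (hgraphU α hα) 0 h0ρ).1.contDiffAt_layer.differentiableAt hr0
    have hα2 : ∀ᶠ q in 𝓝 (φ α, α), (P q 0).2 = q.2 := by
      filter_upwards [hUo.mem_nhds (hgraphU α hα)] with q hq
      exact hsnd q hq
    have hmul : nontrivialMultipliers 1 (fderiv ℝ (fun q => P q 0) (φ α, α)) =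
        multipliers (A α (φ α)) :=
      multipliers_eq_of_charpoly_eq (charpoly_layerMap (p := fun q => P q 0) hd hα2)
    intro μ hμ
    change μ ∈ nontrivialMultipliers 1 (fderiv ℝ (fun q => P q 0) (φ α, α)) at hμ
    rw [hmul] at hμ
    exact (hVα' α hα).2.1 μ hμ
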